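/- Setting. Let $(u,r,\theta,\varphi)$ range over $u\in I$ (a nonempty open interval), $r>R(u,\theta)$ ($R$ continuous), $0<\theta<\pi$, $\varphi\in\mathbb{R}/2\pi\mathbb{Z}$, and let $g$ be a smooth metric of signature $(+,-,-,-)$ there, with a smooth null tetrad $l=\partial_r$, $n=\partial_u+Q\,\partial_r+C^i\partial_i$, $m=\xi^i\partial_i$ ($i=\theta,\varphi$; $l\cdot n=1$, $m\cdot\overline m=-1$, all other products zero). Call a function $f$ polyhomogeneous if it has an asymptotic expansion $f\sim\sum_{k\ge k_0} f_k\,r^{-k}$ as $r\to\infty$, locally uniform in $(u,\theta,\varphi)$ and differentiable term by term, where each $f_k$ is a polynomial in $\ln r$ of bounded degree with coefficients that are smooth functions of $(u,\theta,\varphi)$. Assume that the spacetime is asymptotically flat in the sense that $Q$, $C^i$, $\xi^i$ are polyhomogeneous with $Q=-\tfrac12+\dots$, with the expansion of $C^i$ starting at order $r^{-2}$ (possibly with logarithms), and with $(\xi^\theta,\xi^\varphi)=\tfrac{1}{\sqrt2}\,(1,-i\csc\theta)\,r^{-1}+\dots$. Theorem. Suppose that the spacetime is axisymmetric, i.e.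 that $\eta=\partial_\varphi$ is a Killing vector field, and that it admits a second Killing vector field $\xi$, linearly independent of $\eta$, such that $\eta$ and $\xi$ span a two-dimensional Lie algebra ($[\eta,\xi]$ is a linear combination of $\eta$ and $\xi$ with constant coefficients). Write $$\xi=a\,l+b\,n-c\,m-\overline c\,\overline m,\qquad a,b \text{ real},\ c\text{ complex},$$ and suppose that $a$ and $c$ have polyhomogeneous expansions $a=a_{-1}r+a_0+a_1r^{-1}+\cdots$ and $c=c_{-1}r+c_0+c_1r^{-1}+\cdots$, where $a_k$, $c_k$ are polynomials in $\ln r$. Then: 1. $[\eta,\xi]=0$, so that the algebra is Abelian. 2. There are a constant $A_0\in\mathbb{C}$ and a smooth real function $\alpha$ of $\theta\in(0,\pi)$ such that $a_{-1}$ and $c_{-1}$ contain no logarithms, $b$ does not depend on $r$, and $$c_{-1}=A_0\sin\theta,\qquad a_{-1}=\tfrac{1}{\sqrt2}\,(A_0+\overline{A}_0)\cos\theta,\qquad b=-\tfrac{u}{\sqrt2}\,(A_0+\overline{A}_0)\cos\theta+\alpha(\theta).$$ 3. With $\kappa=\sqrt2\,\mathrm{Re}\,A_0$, the field $\xi$ has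 at null infinity the asymptotic form $$\xi^\mu\approx\bigl(-\kappa u\cos\theta+\alpha(\theta),\ \kappa r\cos\theta,\ -\kappa\sin\theta,\ -\sqrt2\,\mathrm{Im}\,A_0\bigr),$$ where $\approx$ means equality up to $o(1)$ in the $u,\theta,\varphi$ components and up to $o(r)$ in the $r$ component as $r\to\infty$, locally uniformly in $(u,\theta,\varphi)$. 4. The field $\xi+\sqrt2\,\mathrm{Im}(A_0)\,\eta$ is again a Killing vector field, and in the same sense it is asymptotic to the boost-rotation vector field $\bigl(-\kappa u\cos\theta+\alpha(\theta),\ \kappa r\cos\theta,\ -\kappa\sin\theta,\ 0\bigr)$. -/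

import Mathlib

open Filter Topology Asymptotics
open scoped ContDiff ComplexConjugate

noncomputable section

namespace NPKilling

/-- Coordinate points `x = (u, r, θ, φ)`; the angle `φ` is read modulo `2π`. -/
abbrev Coord := Fin 4 → ℝ

/-- Points `(u, θ, φ)` of null infinity. -/
abbrev Scri := ℝ × ℝ × ℝ

/-- The generator of null infinity through the point with coordinates `x`. -/
def toScri (x : Coord) : Scri := (x 0, x 2, x 3)

/-- A neighbourhood of (a piece of) null infinity: the retarded time `u` ranges over an open
interval `I`, the angles over the sphere without the axis, and `r > R(u, θ)`. -/
structure Region where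
  I : Set ℝ
  I_open : IsOpen I
  I_interval : I.OrdConnected
  I_nonempty : I.Nonempty
  R : ℝ × ℝ → ℝ
  R_cont : ContinuousOn R (I ×ˢ Set.Ioo 0 Real.pi)

/-- The domain in spacetime. -/
def Region.dom (D : Region) : Set Coord :=
  {x | x 0 ∈ D.I ∧ x 2 ∈ Set.Ioo 0 Real.pi ∧ D.R (x 0, x 2) < x 1}

/-- The corresponding piece of null infinity. -/
def Region.scri (D : Region) : Set Scri :=
  {p | p.1 ∈ D.I ∧ p.2.1 ∈ Set.Ioo 0 Real.pi}

/-- `(u, θ, φ) → p` and `r → ∞`, jointly. -/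
def nearScri (p : Scri) : Filter Coord :=
  comap toScri (𝓝 p) ⊓ comap (fun x : Coord => x 1) atTop

/-- The truncated series `∑_{k₀ ≤ k ≤ N} f_k r^{-k}`, where each `f_k` is a polynomial
in `ln r` with coefficients depending on `(u, θ, φ)`. -/
def partialSum (coef : ℤ → Scri → Polynomial ℂ) (k₀ N : ℤ) (x : Coord) : ℂ :=
  ∑ k ∈ Finset.Icc k₀ N,
    (coef k (toScri x)).eval ((Real.log (x 1) : ℝ) : ℂ) * ((x 1 : ℝ) : ℂ) ^ (-k)

/-- `f` is polyhomogeneous near null infinity, with expansion `f = ∑_{k ≥ k₀} f_k r^{-k}`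
(an asymptotic expansion that may be differentiated term by term any number of times):
`f_k` is a polynomial in `ln r` of bounded degree whose coefficients are smooth functions of
`(u, θ, φ)`, and all derivatives of `f - ∑_{k ≤ N} f_k r^{-k}` are `o(r^{-N})`, locally
uniformly on null infinity. -/
structure HasPolyhomExpansion (D : Region) (f : Coord → ℂ) (k₀ : ℤ)
    (coef : ℤ → Scri → Polynomial ℂ) : Prop where
  degree_bound : ∃ n : ℤ → ℕ, ∀ k, ∀ p ∈ D.scri, (coef k p).natDegree ≤ n k
  coef_smooth : ∀ k j, ContDiffOn ℝ ∞ (fun p => (coef k p).coeff j) D.scri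
  remainder : ∀ N, k₀ ≤ N → ∀ m : ℕ, ∀ p ∈ D.scri,
    (fun x => ‖iteratedFDeriv ℝ m (fun y => f y - partialSum coef k₀ N y) x‖)
      =o[nearScri p] fun x : Coord => (x 1) ^ (-N)

/-- The translation `φ ↦ φ + 2π`. -/
def turn (x : Coord) : Coord := x + Pi.single 3 (2 * Real.pi)

/-- Functions on the domain that are smooth and `2π`-periodic in `φ`. -/
structure IsSmoothPeriodic {E : Type*} [NormedAddCommGroup E] [NormedSpace ℝ E]
    (D : Region) (f : Coord → E) : Prop where
  smooth : ContDiffOn ℝ ∞ f D.dom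
  periodic : ∀ x ∈ D.dom, f (turn x) = f x

/-- The vector `l = ∂_r`. -/
def lVec : Fin 4 → ℂ := ![0, 1, 0, 0]

/-- The vector `n = ∂_u + Q ∂_r + C^θ ∂_θ + C^φ ∂_φ`. -/
def nVec (Q Cθ Cφ : ℝ) : Fin 4 → ℂ := ![1, Q, Cθ, Cφ]

/-- The complex vector `m = ξ^θ ∂_θ + ξ^φ ∂_φ`. -/
def mVec (Xθ Xφ : ℂ) : Fin 4 → ℂ := ![0, 0, Xθ, Xφ]

/-- The complex bilinear extension of a real bilinear form. -/
def cdot (g : Fin 4 → Fin 4 → ℝ) (v w : Fin 4 → ℂ) : ℂ :=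
  ∑ μ, ∑ ν, (g μ ν : ℂ) * v μ * w ν

/-- A polyhomogeneous asymptotically flat spacetime near null infinity: a metric `g` of
signature `(+,-,-,-)` together with a null tetrad `l = ∂_r`,
`n = ∂_u + Q ∂_r + C^i ∂_i`, `m = ξ^i ∂_i`
(`l·n = 1`, `m·m̄ = -1`, all other products zero) whose components are polyhomogeneous with
`Q = -1/2 + …`, `C^i = O(r^{-2})` up to logarithms and
`ξ^i = (1/√2) (1, -i / sin θ) r^{-1} + …`. -/
structure Spacetime extends Region where
  g : Coord → Fin 4 → Fin 4 → ℝ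
  Q : Coord → ℝ
  Cθ : Coord → ℝ
  Cφ : Coord → ℝ
  Xθ : Coord → ℂ
  Xφ : Coord → ℂ
  g_reg : IsSmoothPeriodic toRegion g
  Q_reg : IsSmoothPeriodic toRegion Q
  Cθ_reg : IsSmoothPeriodic toRegion Cθ
  Cφ_reg : IsSmoothPeriodic toRegion Cφ
  Xθ_reg : IsSmoothPeriodic toRegion Xθ
  Xφ_reg : IsSmoothPeriodic toRegion Xφ
  g_symm : ∀ x ∈ toRegion.dom, ∀ μ ν, g x μ ν = g x ν μ
  ll : ∀ x ∈ toRegion.dom, cdot (g x) lVec lVec = 0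
  ln : ∀ x ∈ toRegion.dom, cdot (g x) lVec (nVec (Q x) (Cθ x) (Cφ x)) = 1
  nn : ∀ x ∈ toRegion.dom,
    cdot (g x) (nVec (Q x) (Cθ x) (Cφ x)) (nVec (Q x) (Cθ x) (Cφ x)) = 0
  lm : ∀ x ∈ toRegion.dom, cdot (g x) lVec (mVec (Xθ x) (Xφ x)) = 0
  nm : ∀ x ∈ toRegion.dom,
    cdot (g x) (nVec (Q x) (Cθ x) (Cφ x)) (mVec (Xθ x) (Xφ x)) = 0
  mm : ∀ x ∈ toRegion.dom, cdot (g x) (mVec (Xθ x) (Xφ x)) (mVec (Xθ x) (Xφ x)) = 0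
  mm_bar : ∀ x ∈ toRegion.dom,
    cdot (g x) (mVec (Xθ x) (Xφ x)) (mVec (conj (Xθ x)) (conj (Xφ x))) = -1
  Q_exp : ∃ coef, HasPolyhomExpansion toRegion (fun x => (Q x : ℂ)) 0 coef ∧
    ∀ p ∈ toRegion.scri, coef 0 p = Polynomial.C (-1 / 2)
  Cθ_exp : ∃ coef, HasPolyhomExpansion toRegion (fun x => (Cθ x : ℂ)) 2 coef
  Cφ_exp : ∃ coef, HasPolyhomExpansion toRegion (fun x => (Cφ x : ℂ)) 2 coef
  Xθ_exp : ∃ coef, HasPolyhomExpansion toRegion Xθ 1 coef ∧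
    ∀ p ∈ toRegion.scri, coef 1 p = Polynomial.C (1 / (Real.sqrt 2 : ℂ))
  Xφ_exp : ∃ coef, HasPolyhomExpansion toRegion Xφ 1 coef ∧
    ∀ p ∈ toRegion.scri,
      coef 1 p = Polynomial.C (-Complex.I / ((Real.sqrt 2 : ℂ) * (Real.sin p.2.1 : ℂ)))

/-- The coordinate partial derivative `∂_μ f` at `x`. -/
def pd (μ : Fin 4) (f : Coord → ℝ) (x : Coord) : ℝ := fderiv ℝ f x (Pi.single μ 1)

/-- `V` is a Killing vector field: `(L_V g)_{μν} = 0`. -/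
structure IsKilling (S : Spacetime) (V : Coord → Coord) : Prop where
  reg : IsSmoothPeriodic S.toRegion V
  killing : ∀ x ∈ S.dom, ∀ μ ν,
    ∑ s, (V x s * pd s (fun y => S.g y μ ν) x
      + S.g x s ν * pd μ (fun y => V y s) x
      + S.g x μ s * pd ν (fun y => V y s) x) = 0

/-- `V = a l + b n - c m - c̄ m̄`. -/
def HasTetradCoeffs (S : Spacetime) (V : Coord → Coord) (a b : Coord → ℝ) (c : Coord → ℂ) :
    Prop :=
  ∀ x ∈ S.dom, ∀ μ, (V x μ : ℂ) =
    (a x : ℂ) * lVec μ + (b x : ℂ) * nVec (S.Q x) (S.Cθ x) (S.Cφ x) μ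
      - c x * mVec (S.Xθ x) (S.Xφ x) μ
      - conj (c x) * mVec (conj (S.Xθ x)) (conj (S.Xφ x)) μ

/-- The axial vector field `η = ∂_φ`. -/
def axial : Coord → Coord := fun _ => ![0, 0, 0, 1]

/-- The spacetime is axisymmetric: `∂_φ` is a Killing vector field. -/
def IsAxisymmetric (S : Spacetime) : Prop := IsKilling S axial

/-- The boost-rotation vector field
`(-κ u cos θ + α(θ), κ r cos θ, -κ sin θ, 0)` in the coordinates `(u, r, θ, φ)`. -/
def boostRotation (κ : ℝ) (α : ℝ → ℝ) : Coord → Coord := fun x =>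
  ![-κ * x 0 * Real.cos (x 2) + α (x 2), κ * x 1 * Real.cos (x 2), -κ * Real.sin (x 2), 0]

/-- `V` and `W` have the same leading terms at null infinity: the `u`, `θ`, `φ` components
agree up to `o(1)` and the `r` components up to `o(r)`. -/
def AsymptoticTo (D : Region) (V W : Coord → Coord) : Prop :=
  ∀ p ∈ D.scri,
    (∀ μ : Fin 4, μ ≠ 1 → (fun x => V x μ - W x μ) =o[nearScri p] fun _ => (1 : ℝ)) ∧
    (fun x => V x 1 - W x 1) =o[nearScri p] fun x : Coord => x 1

end NPKilling

end

/-! Along each φ-circle the bracket hypothesis says that every component of ξ solves f' = s η^μ + t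
f with constant coefficients. Periodicity in φ forces the right-hand side to vanish
(`eq_zero_of_periodic_of_hasDerivAt`), so [η, ξ] = 0 and the components of ξ, like those of g, do
not depend on φ.

The tetrad relations make g_ur = 1 and g_rr = g_rθ = g_rφ = 0 exact. The expansions make the angular
block minus r² times the round metric to leading order, with g_uθ, g_uφ = o(r) and g_uu = o(r²). The
Killing equations with an index r can then be integrated in r: (rr) makes b = ξ^u independent of r;
(rθ) and (rφ) give ∂_r ξ^θ, ∂_r ξ^φ = O(r⁻²), so these components stay bounded; (ur) gives ξ^r / r →
A = -∂_u ξ^u. A bounded polynomial in ln r is constant, so a₋₁ and c₋₁ contain no logarithms, and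
the expansions of a and c upgrade information on single generators to limits locally uniform at null
infinity.

The other equations are divided by r² and passed to the limit (`tendsto_pd_angular`). With X and Y
the limits of ξ^θ and ξ^φ, (φφ) gives A sin θ = -X cos θ, (θθ) and (θφ) give ∂_θ ξ^θ → -A and ∂_θ
ξ^φ → 0, and (uθ), (uφ) give vanishing u-derivatives. Hence Y and X / sin θ are constant
(`exists_limits`): X = k sin θ, A = -k cos θ, Y = w. Now ∂_u ξ^u = k cos θ integrates to k u cos θ +
α(θ) (`exists_alpha`), and comparison with the leading tetrad gives A₀ = -(k + i w) / √2. -/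

noncomputable section

namespace NPKilling

/-! ### Null infinity as a filter -/

/-- The point of the generator `q` of null infinity at radius `r`. -/
def pt (r : ℝ) (q : Scri) : Coord := ![q.1, r, q.2.1, q.2.2]

@[simp] lemma pt_zero (r : ℝ) (q : Scri) : pt r q 0 = q.1 := rfl
@[simp] lemma pt_one (r : ℝ) (q : Scri) : pt r q 1 = r := rfl
@[simp] lemma pt_two (r : ℝ) (q : Scri) : pt r q 2 = q.2.1 := rfl
@[simp] lemma pt_three (r : ℝ) (q : Scri) : pt r q 3 = q.2.2 := rfl
@[simp] lemma toScri_pt (r : ℝ) (q : Scri) : toScri (pt r q) = q := rfl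

lemma pt_toScri (x : Coord) : pt (x 1) (toScri x) = x := by
  ext i; fin_cases i <;> rfl

lemma contDiff_pt : ContDiff ℝ ∞ (fun z : ℝ × Scri => pt z.1 z.2) := by
  rw [contDiff_pi]
  intro i
  fin_cases i
  · exact contDiff_snd.fst
  · exact contDiff_fst
  · exact contDiff_snd.snd.fst
  · exact contDiff_snd.snd.snd

lemma Region.isOpen_dom (D : Region) : IsOpen D.dom := by
  have hU : IsOpen {x : Coord | x 0 ∈ D.I ∧ x 2 ∈ Set.Ioo 0 Real.pi} :=
    (D.I_open.preimage (continuous_apply 0)).inter (isOpen_Ioo.preimage (continuous_apply 2))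
  have hc : ContinuousOn (fun x : Coord => x 1 - D.R (x 0, x 2))
      {x : Coord | x 0 ∈ D.I ∧ x 2 ∈ Set.Ioo 0 Real.pi} :=
    (continuous_apply 1).continuousOn.sub
      (D.R_cont.comp ((continuous_apply 0).prodMk (continuous_apply 2)).continuousOn
        fun x hx => ⟨hx.1, hx.2⟩)
  have := hc.isOpen_inter_preimage hU (isOpen_Ioi (a := (0 : ℝ)))
  convert this using 1
  ext x
  simp [Region.dom, and_assoc]

lemma Region.isOpen_scri (D : Region) : IsOpen D.scri :=
  (D.I_open.preimage continuous_fst).inter (isOpen_Ioo.preimage (continuous_fst.comp continuous_snd))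

lemma Region.convex_scri (D : Region) : Convex ℝ D.scri := by
  intro p hp q hq s t hs ht hst
  exact ⟨D.I_interval.convex hp.1 hq.1 hs ht hst, (convex_Ioo 0 Real.pi) hp.2 hq.2 hs ht hst⟩

lemma Region.mem_scri_of_mem_dom {D : Region} {x : Coord} (hx : x ∈ D.dom) : toScri x ∈ D.scri :=
  ⟨hx.1, hx.2.1⟩

lemma Region.pt_mem_dom {D : Region} {q : Scri} (hq : q ∈ D.scri) {r : ℝ}
    (hr : D.R (q.1, q.2.1) < r) : pt r q ∈ D.dom := ⟨hq.1, hq.2, hr⟩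

lemma tendsto_toScri (p : Scri) : Tendsto toScri (nearScri p) (𝓝 p) :=
  tendsto_comap.mono_left inf_le_left

lemma tendsto_radius (p : Scri) : Tendsto (fun x : Coord => x 1) (nearScri p) atTop :=
  tendsto_comap.mono_left inf_le_right

/-- Restricts locally uniform limits to a single generator, where they can be compared with
one-variable estimates in r. -/
lemma tendsto_pt (p : Scri) : Tendsto (fun r => pt r p) atTop (nearScri p) := by
  refine tendsto_inf.2 ⟨tendsto_comap_iff.2 ?_, tendsto_comap_iff.2 ?_⟩
  · exact tendsto_const_nhds
  · exact tendsto_id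

instance (p : Scri) : (nearScri p).NeBot := (tendsto_pt p).neBot

/-- By continuity of R, one radius serves a whole neighbourhood of generators even though the inner
boundary varies with them. -/
lemma Region.eventually_R_lt {D : Region} {p : Scri} (hp : p ∈ D.scri) {r : ℝ}
    (hr : D.R (p.1, p.2.1) < r) : ∀ᶠ q in 𝓝 p, q ∈ D.scri ∧ D.R (q.1, q.2.1) < r := by
  have h1 : ContinuousAt (fun q : Scri => D.R (q.1, q.2.1)) p := by
    have h2 : ContinuousAt D.R (p.1, p.2.1) :=
      D.R_cont.continuousAt ((D.I_open.prod isOpen_Ioo).mem_nhds ⟨hp.1, hp.2⟩)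
    exact ContinuousAt.comp (f := fun q : Scri => (q.1, q.2.1)) (g := D.R) h2 (by fun_prop)
  exact (show ∀ᶠ q in 𝓝 p, q ∈ D.scri from D.isOpen_scri.mem_nhds hp).and
    (h1.eventually (gt_mem_nhds hr))

lemma Region.eventually_dom {D : Region} {p : Scri} (hp : p ∈ D.scri) :
    ∀ᶠ x in nearScri p, x ∈ D.dom := by
  have h := (tendsto_toScri p).eventually
    (Region.eventually_R_lt hp (lt_add_one (D.R (p.1, p.2.1))))
  filter_upwards [h, (tendsto_radius p).eventually_ge_atTop (D.R (p.1, p.2.1) + 1)] with x h1 h2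
  exact ⟨h1.1.1, h1.1.2, h1.2.trans_le h2⟩

lemma eventually_radius_pos (p : Scri) : ∀ᶠ x in nearScri p, 0 < x 1 :=
  (tendsto_radius p).eventually_gt_atTop 0

lemma pd_congr {D : Region} {f g : Coord → ℝ} (h : ∀ x ∈ D.dom, f x = g x) (μ : Fin 4)
    {x : Coord} (hx : x ∈ D.dom) : pd μ f x = pd μ g x := by
  have : f =ᶠ[𝓝 x] g := by
    filter_upwards [D.isOpen_dom.mem_nhds hx] with y hy using h y hy
  rw [pd, this.fderiv_eq, pd]

/-! ### Leading-order behaviour at null infinity -/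

/-- The leading-order behaviour `f ≈ L r^k` at the point `p` of null infinity, which may be
differentiated once term by term; `Lu` and `Lθ` are the derivatives of `L`. -/
structure Lead {E : Type*} [NormedAddCommGroup E] [NormedSpace ℝ E] (p : Scri)
    (f : Coord → E) (k : ℤ) (L Lu Lθ : E) : Prop where
  diff : ∀ᶠ x in nearScri p, DifferentiableAt ℝ f x
  val : Tendsto (fun x => (x 1) ^ (-k) • f x) (nearScri p) (𝓝 L)
  du : Tendsto (fun x => (x 1) ^ (-k) • fderiv ℝ f x (Pi.single 0 1)) (nearScri p) (𝓝 Lu)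
  dr : Tendsto (fun x => (x 1) ^ (1 - k) • fderiv ℝ f x (Pi.single 1 1)) (nearScri p)
    (𝓝 ((k : ℝ) • L))
  dθ : Tendsto (fun x => (x 1) ^ (-k) • fderiv ℝ f x (Pi.single 2 1)) (nearScri p) (𝓝 Lθ)

section Lead

variable {E : Type*} [NormedAddCommGroup E] [NormedSpace ℝ E]
  {𝕜 : Type*} [NormedField 𝕜] [NormedAlgebra ℝ 𝕜] {p : Scri}

lemma Lead.add {f g : Coord → E} {k : ℤ} {L Lu Lθ M Mu Mθ : E} (hf : Lead p f k L Lu Lθ)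
    (hg : Lead p g k M Mu Mθ) :
    Lead p (fun x => f x + g x) k (L + M) (Lu + Mu) (Lθ + Mθ) := by
  have key : ∀ e : Coord, ∀ᶠ x in nearScri p,
      fderiv ℝ (fun x => f x + g x) x e = fderiv ℝ f x e + fderiv ℝ g x e := fun e => by
    filter_upwards [hf.diff, hg.diff] with x h1 h2
    rw [fderiv_fun_add h1 h2]; rfl
  refine ⟨?_, ?_, ?_, ?_, ?_⟩
  · filter_upwards [hf.diff, hg.diff] with x h1 h2 using h1.add h2
  · simpa only [smul_add] using hf.val.add hg.val
  · refine (hf.du.add hg.du).congr' ?_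
    filter_upwards [key (Pi.single 0 1)] with x h; rw [h, smul_add]
  · rw [smul_add]
    refine (hf.dr.add hg.dr).congr' ?_
    filter_upwards [key (Pi.single 1 1)] with x h; rw [h, smul_add]
  · refine (hf.dθ.add hg.dθ).congr' ?_
    filter_upwards [key (Pi.single 2 1)] with x h; rw [h, smul_add]

lemma Lead.clm {F : Type*} [NormedAddCommGroup F] [NormedSpace ℝ F] (T : E →L[ℝ] F)
    {f : Coord → E} {k : ℤ} {L Lu Lθ : E} (hf : Lead p f k L Lu Lθ) :
    Lead p (fun x => T (f x)) k (T L) (T Lu) (T Lθ) := by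
  have key : ∀ e : Coord, ∀ᶠ x in nearScri p,
      fderiv ℝ (fun x => T (f x)) x e = T (fderiv ℝ f x e) := fun e => by
    filter_upwards [hf.diff] with x h1
    have h2 : HasFDerivAt (fun x => T (f x)) (T.comp (fderiv ℝ f x)) x :=
      T.hasFDerivAt.comp x h1.hasFDerivAt
    rw [h2.fderiv]; rfl
  refine ⟨?_, ?_, ?_, ?_, ?_⟩
  · filter_upwards [hf.diff] with x h1 using T.differentiableAt.comp x h1
  · simpa only [map_smul, Function.comp_def] using (T.continuous.tendsto _).comp hf.val
  · refine ((T.continuous.tendsto _).comp hf.du).congr' ?_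
    filter_upwards [key (Pi.single 0 1)] with x h; rw [h, Function.comp, map_smul]
  · rw [← map_smul]
    refine ((T.continuous.tendsto _).comp hf.dr).congr' ?_
    filter_upwards [key (Pi.single 1 1)] with x h; rw [h, Function.comp, map_smul]
  · refine ((T.continuous.tendsto _).comp hf.dθ).congr' ?_
    filter_upwards [key (Pi.single 2 1)] with x h; rw [h, Function.comp, map_smul]

lemma Lead.neg {f : Coord → E} {k : ℤ} {L Lu Lθ : E} (hf : Lead p f k L Lu Lθ) :
    Lead p (fun x => -f x) k (-L) (-Lu) (-Lθ) := by
  simpa using hf.clm (-(ContinuousLinearMap.id ℝ E))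

lemma Lead.sub {f g : Coord → E} {k : ℤ} {L Lu Lθ M Mu Mθ : E} (hf : Lead p f k L Lu Lθ)
    (hg : Lead p g k M Mu Mθ) :
    Lead p (fun x => f x - g x) k (L - M) (Lu - Mu) (Lθ - Mθ) := by
  simpa only [sub_eq_add_neg] using hf.add hg.neg

lemma Lead.mul {f g : Coord → 𝕜} {k l : ℤ} {L Lu Lθ M Mu Mθ : 𝕜} (hf : Lead p f k L Lu Lθ)
    (hg : Lead p g l M Mu Mθ) :
    Lead p (fun x => f x * g x) (k + l) (L * M) (L * Mu + Lu * M) (L * Mθ + Lθ * M) := by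
  -- The exponent j is 0 for the u and θ derivatives and 1 for the r derivative, which gains a
  -- factor 1/r.
  have key : ∀ (e : Coord) (j : ℤ) (a b : 𝕜),
      Tendsto (fun x => (x 1) ^ (j - k) • fderiv ℝ f x e) (nearScri p) (𝓝 a) →
      Tendsto (fun x => (x 1) ^ (j - l) • fderiv ℝ g x e) (nearScri p) (𝓝 b) →
      Tendsto (fun x => (x 1) ^ (j - (k + l)) • fderiv ℝ (fun x => f x * g x) x e)
        (nearScri p) (𝓝 (L * b + a * M)) := by
    intro e j a b ha hb
    refine ((hf.val.mul hb).add (ha.mul hg.val)).congr' ?_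
    filter_upwards [hf.diff, hg.diff, eventually_radius_pos p] with x h1 h2 h3
    rw [(h1.hasFDerivAt.fun_mul h2.hasFDerivAt).fderiv, smul_mul_smul_comm, smul_mul_smul_comm,
      ← zpow_add₀ h3.ne', ← zpow_add₀ h3.ne']
    simp only [add_apply, smul_apply, smul_eq_mul,
      smul_add]
    rw [mul_comm (g x)]
    congr 3 <;> ring
  refine ⟨?_, ?_, ?_, ?_, ?_⟩
  · filter_upwards [hf.diff, hg.diff] with x h1 h2 using h1.mul h2
  · refine (hf.val.mul hg.val).congr' ?_
    filter_upwards [eventually_radius_pos p] with x h3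
    rw [smul_mul_smul_comm, ← zpow_add₀ h3.ne']; congr 2; ring
  · simpa using key (Pi.single 0 1) 0 _ _ (by simpa using hf.du) (by simpa using hg.du)
  · have := key (Pi.single 1 1) 1 _ _ hf.dr hg.dr
    convert this using 2
    push_cast
    rw [add_smul, mul_smul_comm, smul_mul_assoc, add_comm]
  · simpa using key (Pi.single 2 1) 0 _ _ (by simpa using hf.dθ) (by simpa using hg.dθ)

lemma Lead.inv {f : Coord → ℝ} {k : ℤ} {L Lu Lθ : ℝ} (hf : Lead p f k L Lu Lθ) (hL : L ≠ 0) :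
    Lead p (fun x => (f x)⁻¹) (-k) L⁻¹ (-Lu / L ^ 2) (-Lθ / L ^ 2) := by
  have hne : ∀ᶠ x in nearScri p, f x ≠ 0 := by
    filter_upwards [hf.val.eventually_ne hL] with x h h0
    simp [h0] at h
  have key : ∀ (e : Coord) (j : ℤ) (a : ℝ),
      Tendsto (fun x => (x 1) ^ (j - k) • fderiv ℝ f x e) (nearScri p) (𝓝 a) →
      Tendsto (fun x => (x 1) ^ (j - -k) • fderiv ℝ (fun x => (f x)⁻¹) x e)
        (nearScri p) (𝓝 (-a / L ^ 2)) := by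
    intro e j a ha
    refine (ha.neg.div (hf.val.pow 2) (pow_ne_zero 2 hL)).congr' ?_
    filter_upwards [hf.diff, hne, eventually_radius_pos p] with x h1 h2 h3
    have hd : HasFDerivAt (fun x => (f x)⁻¹) ((-(f x ^ 2)⁻¹) • fderiv ℝ f x) x :=
      (hasDerivAt_inv h2).comp_hasFDerivAt x h1.hasFDerivAt
    rw [hd.fderiv]
    simp only [smul_eq_mul, smul_apply, sub_neg_eq_add]
    rw [show j + k = (j - k) + k + k by ring, zpow_add₀ h3.ne', zpow_add₀ h3.ne']
    have := zpow_ne_zero k h3.ne'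
    simp only [Pi.div_apply, zpow_neg]
    field_simp
  refine ⟨?_, ?_, ?_, ?_, ?_⟩
  · filter_upwards [hf.diff, hne] with x h1 h2 using h1.inv h2
  · refine (hf.val.inv₀ hL).congr' ?_
    filter_upwards with x
    simp [mul_comm]
  · simpa using key (Pi.single 0 1) 0 _ (by simpa using hf.du)
  · have := key (Pi.single 1 1) 1 _ hf.dr
    convert this using 2
    push_cast [smul_eq_mul]
    field_simp
  · simpa using key (Pi.single 2 1) 0 _ (by simpa using hf.dθ)

lemma Lead.congr {D : Region} (hp : p ∈ D.scri) {f g : Coord → E} {k : ℤ} {L Lu Lθ : E}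
    (hf : Lead p f k L Lu Lθ) (h : ∀ x ∈ D.dom, 0 < x 1 → g x = f x) :
    Lead p g k L Lu Lθ := by
  have hev : ∀ᶠ x in nearScri p, g =ᶠ[𝓝 x] f := by
    filter_upwards [Region.eventually_dom hp, eventually_radius_pos p] with x hx hx0
    have h0 : IsOpen {y : Coord | 0 < y 1} := isOpen_lt continuous_const (continuous_apply 1)
    filter_upwards [D.isOpen_dom.mem_nhds hx, h0.mem_nhds hx0] with y hy hy0 using h y hy hy0
  refine ⟨?_, ?_, ?_, ?_, ?_⟩
  · filter_upwards [hf.diff, hev] with x h1 h2 using h2.differentiableAt_iff.2 h1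
  · exact hf.val.congr' (hev.mono fun x hx => by dsimp only; rw [hx.eq_of_nhds])
  · exact hf.du.congr' (hev.mono fun x hx => by dsimp only; rw [hx.fderiv_eq])
  · exact hf.dr.congr' (hev.mono fun x hx => by dsimp only; rw [hx.fderiv_eq])
  · exact hf.dθ.congr' (hev.mono fun x hx => by dsimp only; rw [hx.fderiv_eq])

lemma Lead.of_eq {f : Coord → E} {k k' : ℤ} {L Lu Lθ L' Lu' Lθ' : E}
    (hf : Lead p f k L Lu Lθ) (hk : k = k') (h0 : L = L') (h1 : Lu = Lu') (h2 : Lθ = Lθ') :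
    Lead p f k' L' Lu' Lθ' := by
  subst hk h0 h1 h2; exact hf

lemma Lead.zero (k : ℤ) : Lead p (fun _ => (0 : E)) k 0 0 0 := by
  refine ⟨Eventually.of_forall fun x => differentiableAt_const 0, ?_, ?_, ?_, ?_⟩ <;> simp

lemma Lead.sum {ι : Type*} (s : Finset ι) {f : ι → Coord → E} {k : ℤ}
    (h : ∀ i ∈ s, Lead p (f i) k 0 0 0) : Lead p (fun x => ∑ i ∈ s, f i x) k 0 0 0 := by
  classical
  induction s using Finset.induction_on with
  | empty => simpa using Lead.zero k
  | insert i s hi ih =>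
    simp only [Finset.sum_insert hi]
    refine ((h i (Finset.mem_insert_self i s)).add
      (ih fun j hj => h j (Finset.mem_insert_of_mem hj))).of_eq rfl ?_ ?_ ?_ <;> simp

/-- Coefficients of an expansion enter through this: C¹ regularity near p makes their derivatives
converge jointly, and `toScri` annihilates the radial direction. -/
lemma Lead.comp_toScri {ℓ : Scri → E} (hℓ : ∀ᶠ q in 𝓝 p, ContDiffAt ℝ 1 ℓ q) :
    Lead p (fun x => ℓ (toScri x)) 0 (ℓ p) (fderiv ℝ ℓ p (1, 0, 0)) (fderiv ℝ ℓ p (0, 1, 0)) := by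
  have hT : ∀ x : Coord, HasFDerivAt toScri
      ((ContinuousLinearMap.proj 0).prod ((ContinuousLinearMap.proj 2).prod
        (ContinuousLinearMap.proj 3)) : Coord →L[ℝ] Scri) x := fun x => by
    exact ((ContinuousLinearMap.proj 0).prod ((ContinuousLinearMap.proj 2).prod
        (ContinuousLinearMap.proj 3)) : Coord →L[ℝ] Scri).hasFDerivAt
  have hev := (tendsto_toScri p).eventually hℓ
  have hd : ∀ᶠ x in nearScri p, ∀ e : Coord, fderiv ℝ (fun x => ℓ (toScri x)) x e =
      fderiv ℝ ℓ (toScri x) (e 0, e 2, e 3) := by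
    filter_upwards [hev] with x hx e
    have h := (hx.differentiableAt one_ne_zero).hasFDerivAt.comp x (hT x)
    have h' : fderiv ℝ (fun x => ℓ (toScri x)) x = _ := h.fderiv
    rw [h']; rfl
  have hc : ContinuousAt (fderiv ℝ ℓ) p :=
    (hℓ.self_of_nhds.fderiv_right (m := 0) (by norm_num)).continuousAt
  have hcv : ∀ v : Scri, Tendsto (fun x => fderiv ℝ ℓ (toScri x) v) (nearScri p)
      (𝓝 (fderiv ℝ ℓ p v)) := fun v =>
    ((ContinuousLinearMap.apply ℝ E v).continuous.tendsto _).comp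
      (hc.tendsto.comp (tendsto_toScri p))
  refine ⟨?_, ?_, ?_, ?_, ?_⟩
  · filter_upwards [hev] with x hx
    exact (hx.differentiableAt one_ne_zero).comp x (hT x).differentiableAt
  · simpa [Function.comp_def] using
      hℓ.self_of_nhds.continuousAt.tendsto.comp (tendsto_toScri p)
  · refine (hcv (1, 0, 0)).congr' ?_
    filter_upwards [hd] with x hx; simp [hx]
  · simp only [Int.cast_zero, zero_smul]
    refine tendsto_const_nhds.congr' ?_
    filter_upwards [hd] with x hx
    rw [hx]
    simp [show ((0, 0, 0) : Scri) = 0 from rfl]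
  · refine (hcv (0, 1, 0)).congr' ?_
    filter_upwards [hd] with x hx; simp [hx]

lemma Lead.of_radial {h h' : ℝ → E} {k : ℤ} {L : E}
    (hd : ∀ᶠ r in atTop, HasDerivAt h (h' r) r)
    (h0 : Tendsto (fun r : ℝ => r ^ (-k) • h r) atTop (𝓝 L))
    (h1 : Tendsto (fun r : ℝ => r ^ (1 - k) • h' r) atTop (𝓝 ((k : ℝ) • L))) :
    Lead p (fun x => h (x 1)) k L 0 0 := by
  have hev := (tendsto_radius p).eventually hd
  have key : ∀ᶠ x in nearScri p, HasFDerivAt (fun x : Coord => h (x 1))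
      ((ContinuousLinearMap.proj 1 : Coord →L[ℝ] ℝ).smulRight (h' (x 1))) x := by
    filter_upwards [hev] with x hx
    have := hx.hasFDerivAt.comp x (ContinuousLinearMap.proj (R := ℝ) (φ := fun _ : Fin 4 => ℝ) 1).hasFDerivAt
    exact this
  refine ⟨key.mono fun x hx => hx.differentiableAt, h0.comp (tendsto_radius p), ?_, ?_, ?_⟩
  · refine tendsto_const_nhds.congr' (key.mono fun x hx => ?_)
    dsimp only [Function.comp]; rw [hx.fderiv]; simp
  · refine (h1.comp (tendsto_radius p)).congr' (key.mono fun x hx => ?_)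
    dsimp only [Function.comp]; rw [hx.fderiv]; simp
  · refine tendsto_const_nhds.congr' (key.mono fun x hx => ?_)
    dsimp only [Function.comp]; rw [hx.fderiv]; simp

lemma Lead.radius_zpow (k : ℤ) : Lead p (fun x => (x 1) ^ k) k (1 : ℝ) 0 0 := by
  refine Lead.of_radial (h' := fun r => k * r ^ (k - 1)) (h := fun r : ℝ => r ^ k) ?_ ?_ ?_
  · filter_upwards [eventually_gt_atTop 0] with r hr using hasDerivAt_zpow k r (Or.inl hr.ne')
  · refine tendsto_const_nhds.congr' ?_
    filter_upwards [eventually_gt_atTop 0] with r hr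
    rw [smul_eq_mul, ← zpow_add₀ hr.ne']; simp
  · refine tendsto_const_nhds.congr' ?_
    filter_upwards [eventually_gt_atTop 0] with r hr
    rw [smul_eq_mul, smul_eq_mul, mul_left_comm, ← zpow_add₀ hr.ne']; simp

lemma tendsto_log_pow_div (j : ℕ) :
    Tendsto (fun r : ℝ => r⁻¹ * Real.log r ^ j) atTop (𝓝 0) := by
  have := (Real.isLittleO_pow_log_id_atTop (n := j)).tendsto_div_nhds_zero
  simpa [div_eq_inv_mul] using this

/-- Logarithms are absorbed at the cost of one power of r, with leading coefficient zero. This is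
the source of the loss `1 - k₀` in `HasPolyhomExpansion.lead_zero`. -/
lemma Lead.log_pow (j : ℕ) : Lead p (fun x => Real.log (x 1) ^ j) 1 (0 : ℝ) 0 0 := by
  refine Lead.of_radial (h := fun r => Real.log r ^ j)
    (h' := fun r => j * Real.log r ^ (j - 1) * r⁻¹) ?_ ?_ ?_
  · filter_upwards [eventually_gt_atTop 0] with r hr
    exact (Real.hasDerivAt_log hr.ne').pow j
  · simpa using tendsto_log_pow_div j
  · have := (tendsto_log_pow_div (j - 1)).const_mul (j : ℝ)
    simp only [mul_zero] at this
    simp only [sub_self, zpow_zero, one_smul, smul_zero]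
    refine this.congr fun r => by ring

end Lead

/-! ### Leading-order behaviour of polyhomogeneous functions -/

section Polyhom

variable {D : Region} {f : Coord → ℂ} {k₀ : ℤ} {coef : ℤ → Scri → Polynomial ℂ} {p : Scri}

lemma partialSum_self (coef : ℤ → Scri → Polynomial ℂ) (k : ℤ) (x : Coord) :
    partialSum coef k k x =
      (coef k (toScri x)).eval ((Real.log (x 1) : ℝ) : ℂ) * ((x 1 : ℝ) : ℂ) ^ (-k) := by
  simp [partialSum]

lemma partialSum_succ (coef : ℤ → Scri → Polynomial ℂ) {k N : ℤ} (h : k ≤ N) (x : Coord) :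
    partialSum coef k N x = partialSum coef k k x + partialSum coef (k + 1) N x := by
  have : Finset.Icc k N = insert k (Finset.Icc (k + 1) N) := by
    ext j; simp only [Finset.mem_Icc, Finset.mem_insert]; omega
  rw [partialSum_self, partialSum, this, Finset.sum_insert (by simp), partialSum]

lemma HasPolyhomExpansion.eventually_contDiffAt_coeff (h : HasPolyhomExpansion D f k₀ coef)
    (hp : p ∈ D.scri) (k : ℤ) (j : ℕ) :
    ∀ᶠ q in 𝓝 p, ContDiffAt ℝ 1 (fun q => (coef k q).coeff j) q := by
  filter_upwards [D.isOpen_scri.mem_nhds hp] with q hq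
  exact ((h.coef_smooth k j).contDiffAt (D.isOpen_scri.mem_nhds hq)).of_le (by norm_cast)

lemma HasPolyhomExpansion.lead_term (h : HasPolyhomExpansion D f k₀ coef) (hp : p ∈ D.scri)
    (k : ℤ) : Lead p (partialSum coef k k) (1 - k) 0 0 0 := by
  obtain ⟨n, hn⟩ := h.degree_bound
  have h1 : ∀ j ∈ Finset.range (n k + 1), Lead p (fun x => (coef k (toScri x)).coeff j *
      Complex.ofRealCLM (Real.log (x 1) ^ j * (x 1) ^ (-k))) (1 - k) 0 0 0 := by
    intro j _
    refine ((Lead.comp_toScri (h.eventually_contDiffAt_coeff hp k j)).mul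
      (((Lead.log_pow j).mul (Lead.radius_zpow (-k))).clm Complex.ofRealCLM)).of_eq ?_ ?_ ?_ ?_
    · ring
    all_goals simp
  refine (Lead.sum _ h1).congr hp fun x hx hx0 => ?_
  rw [partialSum_self, Polynomial.eval_eq_sum_range'
    (Nat.lt_succ_of_le (hn k _ (Region.mem_scri_of_mem_dom hx))), Finset.sum_mul]
  refine Finset.sum_congr rfl fun j _ => ?_
  simp [mul_assoc]

/-- A polyhomogeneous function whose expansion starts at order `r^{-k₀}`, possibly with
logarithms, is `o(r^{1-k₀})`. -/
lemma HasPolyhomExpansion.lead_zero (h : HasPolyhomExpansion D f k₀ coef)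
    (hf : ∀ᶠ x in nearScri p, DifferentiableAt ℝ f x) (hp : p ∈ D.scri) : Lead p f (1 - k₀) 0 0 0 := by
  have hT := h.lead_term hp k₀
  have hr0 := h.remainder k₀ le_rfl 0 p hp
  have hr1 := h.remainder k₀ le_rfl 1 p hp
  simp only [norm_iteratedFDeriv_zero, norm_iteratedFDeriv_one] at hr0 hr1
  set R : Coord → ℂ := fun y => f y - partialSum coef k₀ k₀ y with hR
  -- The remainder and its first derivatives are all o(r^{-k₀}). The largest weight required is
  -- r^{k₀}, for the radial derivative, and it is still allowed.
  have hz : ∀ F : Coord → ℂ, F =o[nearScri p] (fun x : Coord => (x 1) ^ (-k₀)) →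
      ∀ j : ℤ, j ≤ k₀ → Tendsto (fun x => (x 1) ^ j • F x) (nearScri p) (𝓝 0) := by
    intro F hF j hj
    have h2 : (fun x : Coord => (x 1) ^ j • F x) =o[nearScri p]
        fun x => (x 1) ^ j • (x 1) ^ (-k₀) := (isBigO_refl _ _).smul_isLittleO hF
    have h3 : (fun x : Coord => (x 1) ^ j • (x 1) ^ (-k₀)) =O[nearScri p]
        (fun _ => (1 : ℝ)) := by
      refine IsBigO.of_bound 1 ?_
      filter_upwards [(tendsto_radius p).eventually_ge_atTop 1] with x hx
      rw [smul_eq_mul, ← zpow_add₀ (by positivity), Real.norm_of_nonneg (by positivity)]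
      simpa using zpow_le_one_of_nonpos₀ hx (by omega : j + -k₀ ≤ 0)
    exact (isLittleO_one_iff ℝ).1 (h2.trans_isBigO h3)
  have hd : ∀ e : Coord, (fun x => fderiv ℝ R x e) =o[nearScri p]
      (fun x : Coord => (x 1) ^ (-k₀)) := fun e => by
    refine IsBigO.trans_isLittleO (IsBigO.of_bound ‖e‖ ?_) hr1
    filter_upwards with x
    rw [norm_norm, mul_comm]
    exact (fderiv ℝ R x).le_opNorm e
  have hRl : Lead p R (1 - k₀) 0 0 0 := by
    refine ⟨?_, ?_, ?_, ?_, ?_⟩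
    · filter_upwards [hf, hT.diff] with x h1 h2 using h1.sub h2
    · exact hz R hr0.of_norm_left _ (by omega)
    · exact hz _ (hd _) _ (by omega)
    · simpa using hz _ (hd (Pi.single 1 1)) (1 - (1 - k₀)) (by omega)
    · exact hz _ (hd _) _ (by omega)
  refine (hT.add hRl).congr hp (fun x _ _ => ?_) |>.of_eq rfl ?_ ?_ ?_
  · simp [hR]
  all_goals simp

/-- A polyhomogeneous function whose leading term `ℓ r^{-k₀}` contains no logarithms. -/
lemma HasPolyhomExpansion.lead (h : HasPolyhomExpansion D f k₀ coef)
    (hf : ∀ᶠ x in nearScri p, DifferentiableAt ℝ f x) (hp : p ∈ D.scri) {ℓ : Scri → ℂ}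
    (hℓ : ∀ q ∈ D.scri, coef k₀ q = Polynomial.C (ℓ q)) :
    Lead p f (-k₀) (ℓ p) (fderiv ℝ ℓ p (1, 0, 0)) (fderiv ℝ ℓ p (0, 1, 0)) := by
  have hc : ∀ {q}, q ∈ D.scri → ∀ᶠ q' in 𝓝 q, ContDiffAt ℝ 1 ℓ q' := by
    intro q hq
    filter_upwards [h.eventually_contDiffAt_coeff hq k₀ 0, D.isOpen_scri.mem_nhds hq]
      with q' h1 h2
    refine h1.congr_of_eventuallyEq ?_
    filter_upwards [D.isOpen_scri.mem_nhds h2] with q'' h3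
    simp [hℓ q'' h3]
  have hL : ∀ {q}, q ∈ D.scri → Lead q (partialSum coef k₀ k₀) (-k₀) (ℓ q)
      (fderiv ℝ ℓ q (1, 0, 0)) (fderiv ℝ ℓ q (0, 1, 0)) := by
    intro q hq
    refine (((Lead.comp_toScri (hc hq)).mul ((Lead.radius_zpow (-k₀)).clm
      Complex.ofRealCLM)).of_eq ?_ ?_ ?_ ?_).congr hq fun x hx hx0 => ?_
    · ring
    · simp
    · simp
    · simp
    · rw [partialSum_self, hℓ _ (Region.mem_scri_of_mem_dom hx)]
      simp
  -- Without its leading term the function has an expansion starting one order later. The crude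
  -- bound for that expansion is o(r^{-k₀}), which is negligible against the leading term.
  have hg : HasPolyhomExpansion D (fun x => f x - partialSum coef k₀ k₀ x) (k₀ + 1) coef := by
    refine ⟨h.degree_bound, h.coef_smooth, fun N hN m q hq => ?_⟩
    simpa only [partialSum_succ coef (show k₀ ≤ N by omega), ← sub_sub]
      using h.remainder N (by omega) m q hq
  have hg0 := hg.lead_zero (by filter_upwards [hf, (hL hp).diff] with x h1 h2 using h1.sub h2) hp
  refine (((hL hp).add (hg0.of_eq (by ring) rfl rfl rfl)).congr hp fun x _ _ => ?_).of_eq rfl ?_ ?_ ?_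
  · simp
  all_goals simp

/-- A polyhomogeneous function divided by its leading power of `r` is asymptotic to a polynomial
in `ln r`. -/
lemma HasPolyhomExpansion.tendsto_sub_eval (h : HasPolyhomExpansion D f k₀ coef)
    (hp : p ∈ D.scri) :
    Tendsto (fun x => (x 1) ^ k₀ • f x - (coef k₀ (toScri x)).eval ((Real.log (x 1) : ℝ) : ℂ))
      (nearScri p) (𝓝 0) := by
  have hr0 := h.remainder k₀ le_rfl 0 p hp
  simp only [norm_iteratedFDeriv_zero] at hr0
  have h2 := (isBigO_refl (fun x : Coord => (x 1) ^ k₀) (nearScri p)).smul_isLittleO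
    hr0.of_norm_left
  have h3 : (fun x : Coord => (x 1) ^ k₀ • (x 1) ^ (-k₀)) =ᶠ[nearScri p]
        (fun _ => (1 : ℝ)) := by
    filter_upwards [eventually_radius_pos p] with x hx
    rw [smul_eq_mul, ← zpow_add₀ hx.ne']; simp
  refine ((isLittleO_one_iff ℝ).1 (h2.trans_eventuallyEq h3)).congr' ?_
  filter_upwards [eventually_radius_pos p] with x hx
  rw [partialSum_self, smul_sub, Complex.real_smul, Complex.real_smul, mul_left_comm]
  have : ((x 1 ^ k₀ : ℝ) : ℂ) * ((x 1 : ℝ) : ℂ) ^ (-k₀) = 1 := by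
    rw [Complex.ofReal_zpow, ← zpow_add₀ (by exact_mod_cast hx.ne')]; simp
  rw [this, mul_one]

/-- A nonconstant polynomial is unbounded as its argument ln r tends to infinity. -/
lemma natDegree_eq_zero_of_isBigO_log {P : Polynomial ℂ}
    (h : (fun r : ℝ => P.eval ((Real.log r : ℝ) : ℂ)) =O[atTop] (fun _ => (1 : ℝ))) :
    P.natDegree = 0 := by
  by_contra h0
  have h1 : Tendsto (fun r : ℝ => ‖((Real.log r : ℝ) : ℂ)‖) atTop atTop := by
    simpa [Function.comp_def] using tendsto_abs_atTop_atTop.comp Real.tendsto_log_atTop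
  have h2 := P.tendsto_norm_atTop (Polynomial.natDegree_pos_iff_degree_pos.1 (Nat.pos_of_ne_zero h0)) h1
  obtain ⟨K, hK⟩ := h.bound
  obtain ⟨r, hr1, hr2⟩ := (hK.and (h2.eventually_gt_atTop (K * ‖(1 : ℝ)‖))).exists
  exact absurd hr1 (not_le.2 hr2)

/-- If a polyhomogeneous function is `O(r^{-k₀})` along every generator of null infinity, then its
leading coefficient contains no logarithms. -/
lemma HasPolyhomExpansion.coef_eq_C (h : HasPolyhomExpansion D f k₀ coef) (hp : p ∈ D.scri)
    (hO : (fun r : ℝ => r ^ k₀ • f (pt r p)) =O[atTop] (fun _ => (1 : ℝ))) :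
    coef k₀ p = Polynomial.C ((coef k₀ p).coeff 0) := by
  refine Polynomial.eq_C_of_natDegree_eq_zero (natDegree_eq_zero_of_isBigO_log ?_)
  have h1 := ((h.tendsto_sub_eval hp).comp (tendsto_pt p)).isBigO_one ℝ
  refine (hO.sub h1).congr_left fun r => ?_
  simp

/-- Once logarithms are excluded on every generator, continuity of the coefficient and local
uniformity of the remainder give a joint limit. -/
lemma HasPolyhomExpansion.tendsto_coeff_zero (h : HasPolyhomExpansion D f k₀ coef)
    (hp : p ∈ D.scri) (hC : ∀ q ∈ D.scri, coef k₀ q = Polynomial.C ((coef k₀ q).coeff 0)) :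
    Tendsto (fun x => (x 1) ^ k₀ • f x) (nearScri p) (𝓝 ((coef k₀ p).coeff 0)) := by
  have h2 := (h.eventually_contDiffAt_coeff hp k₀ 0).self_of_nhds.continuousAt.tendsto.comp
    (tendsto_toScri p)
  have := (h.tendsto_sub_eval hp).add h2
  rw [zero_add] at this
  refine this.congr' ?_
  filter_upwards [Region.eventually_dom hp] with x hx
  rw [hC _ (Region.mem_scri_of_mem_dom hx)]
  simp

end Polyhom

/-! ### Functions along coordinate lines -/

/-- A form of l'Hôpital's rule: the mean value inequality for f - L r bounds its growth by ε r / 2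
plus a constant. -/
lemma tendsto_div_of_tendsto_deriv {f f' : ℝ → ℝ} {L : ℝ}
    (hd : ∀ᶠ r in atTop, HasDerivAt f (f' r) r) (h : Tendsto f' atTop (𝓝 L)) :
    Tendsto (fun r => r⁻¹ * f r) atTop (𝓝 L) := by
  rw [Metric.tendsto_atTop]
  intro ε hε
  obtain ⟨r₀, h0⟩ := eventually_atTop.1
    (hd.and ((Metric.tendsto_nhds.1 h (ε / 2) (half_pos hε)).and (eventually_gt_atTop 0)))
  have hr0 : 0 < r₀ := (h0 r₀ le_rfl).2.2
  have hb : ∀ r ≥ r₀, |(f r - L * r) - (f r₀ - L * r₀)| ≤ ε / 2 * (r - r₀) := by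
    intro r hr
    have := Convex.norm_image_sub_le_of_norm_hasDerivWithin_le
      (f := fun r => f r - L * r) (f' := fun r => f' r - L * 1) (s := Set.Ici r₀) (C := ε / 2)
      (fun y hy => (((h0 y hy).1).sub ((hasDerivAt_id y).const_mul L)).hasDerivWithinAt)
      (fun y hy => by
        have := (h0 y hy).2.1.le
        rwa [Real.dist_eq, ← Real.norm_eq_abs, ← mul_one L] at this) (convex_Ici r₀) (Set.self_mem_Ici) hr
    rwa [Real.norm_eq_abs, Real.norm_of_nonneg (sub_nonneg.2 hr)] at this
  set K := |f r₀ - L * r₀| with hK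
  refine ⟨max r₀ (2 * K / ε + 1), fun r hr => ?_⟩
  have h1 : r₀ ≤ r := (le_max_left _ _).trans hr
  have h2 : 2 * K / ε < r := by linarith [(le_max_right r₀ (2 * K / ε + 1)).trans hr]
  have hr' : 0 < r := hr0.trans_le h1
  rw [Real.dist_eq, show r⁻¹ * f r - L = r⁻¹ * (f r - L * r) by field_simp, abs_mul,
    abs_of_pos (inv_pos.2 hr'), inv_mul_lt_iff₀ hr']
  have h3 := hb r h1
  have h4 := abs_sub_abs_le_abs_sub (f r - L * r) (f r₀ - L * r₀)
  rw [div_lt_iff₀ hε] at h2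
  nlinarith

/-- Since |f'| ≤ K / r² for large r, f + K / r decreases and f - K / r increases, which traps f
between constants. -/
lemma isBigO_one_of_tendsto_sq_mul_deriv {f f' : ℝ → ℝ} {L : ℝ}
    (hd : ∀ᶠ r in atTop, HasDerivAt f (f' r) r)
    (h : Tendsto (fun r => r ^ 2 * f' r) atTop (𝓝 L)) :
    f =O[atTop] (fun _ => (1 : ℝ)) := by
  obtain ⟨K, hK⟩ := (h.isBigO_one ℝ).bound
  obtain ⟨r₀, h0⟩ := eventually_atTop.1 (hd.and (hK.and (eventually_gt_atTop 0)))
  have hr0 : 0 < r₀ := (h0 r₀ le_rfl).2.2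
  have hb : ∀ r ≥ r₀, 0 < r ∧ -(K / r ^ 2) ≤ f' r ∧ f' r ≤ K / r ^ 2 := by
    intro r hr
    obtain ⟨-, h1, h2⟩ := h0 r hr
    refine ⟨h2, ?_⟩
    rw [norm_one, mul_one, norm_mul, Real.norm_of_nonneg (sq_nonneg r), Real.norm_eq_abs] at h1
    rw [← abs_le, le_div_iff₀ (by positivity)]
    linarith
  have hinv : ∀ r ≥ r₀, HasDerivAt (fun r => K * r⁻¹) (K * -(r ^ 2)⁻¹) r := fun r hr =>
    (hasDerivAt_inv (hb r hr).1.ne').const_mul K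
  have h1 : AntitoneOn (fun r => f r + K * r⁻¹) (Set.Ici r₀) := by
    refine antitoneOn_of_hasDerivWithinAt_nonpos (convex_Ici r₀)
      (fun r hr => ((h0 r hr).1.add (hinv r hr)).continuousAt.continuousWithinAt)
      (fun r hr => ((h0 r (interior_subset hr)).1.add (hinv r (interior_subset hr))).hasDerivWithinAt)
      (fun r hr => ?_)
    have := (hb r (interior_subset hr)).2.2
    rw [div_eq_mul_inv] at this
    linarith
  have h2 : MonotoneOn (fun r => f r - K * r⁻¹) (Set.Ici r₀) := by
    refine monotoneOn_of_hasDerivWithinAt_nonneg (convex_Ici r₀)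
      (fun r hr => ((h0 r hr).1.sub (hinv r hr)).continuousAt.continuousWithinAt)
      (fun r hr => ((h0 r (interior_subset hr)).1.sub (hinv r (interior_subset hr))).hasDerivWithinAt)
      (fun r hr => ?_)
    have := (hb r (interior_subset hr)).2.1
    rw [div_eq_mul_inv] at this
    linarith
  have hK0 : 0 ≤ K := by
    have h3 := hb r₀ le_rfl
    have h4 : 0 ≤ K / r₀ ^ 2 := by linarith [h3.2.1.trans h3.2.2]
    rcases le_or_gt 0 K with h5 | h5
    · exact h5
    · exact absurd h4 (not_le.2 (div_neg_of_neg_of_pos h5 (by positivity)))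
  refine IsBigO.of_bound (|f r₀| + K * r₀⁻¹) ?_
  filter_upwards [eventually_ge_atTop r₀] with r hr
  have e1 := h1 (Set.self_mem_Ici) hr hr
  have e2 := h2 (Set.self_mem_Ici) hr hr
  have e3 : 0 ≤ K * r⁻¹ := mul_nonneg hK0 (inv_nonneg.2 (hb r hr).1.le)
  simp only at e1 e2
  rw [norm_one, mul_one, Real.norm_eq_abs, abs_le]
  constructor <;> linarith [le_abs_self (f r₀), neg_abs_le (f r₀)]

/-- A periodic solution of `f' = s + t f` is constant. -/
lemma eq_zero_of_periodic_of_hasDerivAt {f : ℝ → ℝ} {s t : ℝ}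
    (hd : ∀ y, HasDerivAt f (s + t * f y) y) (hp : ∀ y, f (y + 2 * Real.pi) = f y) (y : ℝ) :
    s + t * f y = 0 := by
  have hpi := Real.pi_pos
  rcases eq_or_ne t 0 with rfl | ht
  · have hc : ∀ y, HasDerivAt (fun y => f y - s * y) 0 y := fun y => by
      exact ((hd y).sub ((hasDerivAt_id y).const_mul s)).congr_deriv (by simp)
    have := is_const_of_deriv_eq_zero (fun y => (hc y).differentiableAt) (fun y => (hc y).deriv)
      (0 + 2 * Real.pi) 0
    rw [hp 0] at this
    have h2 : s * Real.pi = 0 := by linarith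
    rcases mul_eq_zero.1 h2 with h | h
    · simp [h]
    · exact absurd h hpi.ne'
  -- Integrating factor. Comparing the conserved quantity at y and y + 2π, a nonzero s + t f would
  -- force exp(-2πt) = 1, hence t = 0.
  · have hc : ∀ y, HasDerivAt (fun y => (s + t * f y) * Real.exp (-t * y)) 0 y := fun y => by
      have h1 := ((hd y).const_mul t).const_add s
      have h2 := ((hasDerivAt_id y).const_mul (-t)).exp
      refine (h1.mul h2).congr_deriv ?_
      simp only [id]
      ring
    have := is_const_of_deriv_eq_zero (fun y => (hc y).differentiableAt) (fun y => (hc y).deriv)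
      (y + 2 * Real.pi) y
    simp only [hp y] at this
    by_contra h0
    have h3 := Real.exp_injective (mul_left_cancel₀ h0 this)
    have h4 : t * Real.pi = 0 := by linarith
    rcases mul_eq_zero.1 h4 with h | h
    · exact ht h
    · exact hpi.ne' h

/-! ### Restriction to coordinate lines, radial constancy and limits at null infinity -/

section Lines

variable {E : Type*} [NormedAddCommGroup E] [NormedSpace ℝ E] {D : Region} {F : Coord → E}

lemma pt_add_smul (r s t : ℝ) (q v : Scri) : pt (r + t * s) (q + t • v) = pt r q + t • pt s v := by
  ext i; fin_cases i <;> simp [pt]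

lemma hasDerivAt_line {r s t : ℝ} {q v : Scri}
    (h : DifferentiableAt ℝ F (pt (r + t * s) (q + t • v))) :
    HasDerivAt (fun t => F (pt (r + t * s) (q + t • v)))
      (fderiv ℝ F (pt (r + t * s) (q + t • v)) (pt s v)) t := by
  have h1 : HasDerivAt (fun t : ℝ => pt (r + t * s) (q + t • v)) (pt s v) t := by
    simp only [pt_add_smul]
    simpa using ((hasDerivAt_id t).smul_const (pt s v)).const_add (pt r q)
  exact h.hasFDerivAt.comp_hasDerivAt t h1

lemma pt_one_zero : pt 1 0 = Pi.single 1 1 := by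
  ext i; fin_cases i <;> simp [pt]

lemma hasDerivAt_radial {r : ℝ} {q : Scri} (h : DifferentiableAt ℝ F (pt r q)) :
    HasDerivAt (fun r => F (pt r q)) (fderiv ℝ F (pt r q) (Pi.single 1 1)) r := by
  have := hasDerivAt_line (F := F) (r := 0) (s := 1) (t := r) (q := q) (v := 0) (by simpa using h)
  simpa [pt_one_zero] using this

lemma differentiableAt_of_mem_dom (hF : DifferentiableOn ℝ F D.dom) {x : Coord} (hx : x ∈ D.dom) :
    DifferentiableAt ℝ F x := hF.differentiableAt (D.isOpen_dom.mem_nhds hx)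

/-- Functions that are constant along the generators `l = ∂_r`. -/
def RadiallyConstant (D : Region) (F : Coord → E) : Prop :=
  ∀ q ∈ D.scri, ∀ r, D.R (q.1, q.2.1) < r → ∀ r', D.R (q.1, q.2.1) < r' →
    F (pt r q) = F (pt r' q)

lemma radiallyConstant_of_fderiv (hF : DifferentiableOn ℝ F D.dom)
    (h : ∀ x ∈ D.dom, fderiv ℝ F x (Pi.single 1 1) = 0) : RadiallyConstant D F := by
  intro q hq r hr r' hr'
  have hd : ∀ y ∈ Set.Ioi (D.R (q.1, q.2.1)), HasDerivAt (fun r => F (pt r q)) 0 y := by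
    intro y hy
    have hx := Region.pt_mem_dom hq hy
    simpa [h _ hx] using hasDerivAt_radial (differentiableAt_of_mem_dom hF hx)
  exact isOpen_Ioi.is_const_of_deriv_eq_zero isPreconnected_Ioi
    (fun y hy => (hd y hy).differentiableAt.differentiableWithinAt)
    (fun y hy => (hd y hy).deriv) hr hr'

/-- Near a point, F agrees with its translate by r' - r in the radial direction, and differentiation
commutes with translation. -/
lemma RadiallyConstant.fderiv (h : RadiallyConstant D F) : RadiallyConstant D (fderiv ℝ F) := by
  intro q hq r hr r' hr'
  set a : Coord := pt (r' - r) 0 with ha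
  have hs : ∀ y : Coord, y + a = pt (y 1 + (r' - r)) (toScri y) := by
    intro y; ext i; fin_cases i <;> simp [ha, pt, toScri]
  have e : pt r q + a = pt r' q := by rw [hs]; simp
  rw [← e, ← fderiv_comp_add_right]
  refine Filter.EventuallyEq.fderiv_eq ?_
  have h1 := D.isOpen_dom.mem_nhds (Region.pt_mem_dom hq hr)
  have h2 : ∀ᶠ y in 𝓝 (pt r q), y + a ∈ D.dom := by
    have hc : ContinuousAt (fun y : Coord => y + a) (pt r q) := by fun_prop
    refine hc.eventually (D.isOpen_dom.mem_nhds ?_)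
    simpa only [e] using Region.pt_mem_dom hq hr'
  filter_upwards [h1, h2] with y hy1 hy2
  rw [hs] at hy2
  rw [hs]
  conv_lhs => rw [← pt_toScri y]
  exact h _ (Region.mem_scri_of_mem_dom hy1) _ hy1.2.2 _ hy2.2.2

lemma RadiallyConstant.eventually_eq {G : Type*} {F : Coord → G} (h : RadiallyConstant D F) {p : Scri} (hp : p ∈ D.scri)
    {r : ℝ} (hr : D.R (p.1, p.2.1) < r) :
    ∀ᶠ q in 𝓝 p, ∀ r', D.R (q.1, q.2.1) < r' → F (pt r' q) = F (pt r q) := by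
  filter_upwards [Region.eventually_R_lt hp hr] with q hq r' hr' using h q hq.1 _ hr' _ hq.2

lemma RadiallyConstant.tendsto (h : RadiallyConstant D F) (hF : ContinuousOn F D.dom) {p : Scri}
    (hp : p ∈ D.scri) {r : ℝ} (hr : D.R (p.1, p.2.1) < r) :
    Tendsto F (nearScri p) (𝓝 (F (pt r p))) := by
  have h1 : Tendsto (fun q => F (pt r q)) (𝓝 p) (𝓝 (F (pt r p))) := by
    have h2 : ContinuousAt F (pt r p) :=
      hF.continuousAt (D.isOpen_dom.mem_nhds (Region.pt_mem_dom hp hr))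
    have h3 : ContinuousAt (fun q : Scri => pt r q) p :=
      (contDiff_pt.continuous.comp (Continuous.prodMk_right r)).continuousAt
    exact ContinuousAt.comp (f := fun q : Scri => pt r q) h2 h3
  refine (h1.comp (tendsto_toScri p)).congr' ?_
  filter_upwards [Region.eventually_dom hp, (tendsto_toScri p).eventually (h.eventually_eq hp hr)]
    with x hx hx'
  rw [Function.comp, ← hx' (x 1) hx.2.2, pt_toScri]

/-- Makes the uniformity explicit: a single radius works for all generators near p. -/
lemma exists_of_eventually_nearScri {p : Scri} {P : Coord → Prop} (h : ∀ᶠ x in nearScri p, P x) :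
    ∃ U ∈ 𝓝 p, ∃ r₀, ∀ q ∈ U, ∀ r ≥ r₀, P (pt r q) := by
  obtain ⟨⟨U, r₀⟩, h1, h2⟩ :=
    (((𝓝 p).basis_sets.comap toScri).inf (atTop_basis.comap fun x : Coord => x 1)).eventually_iff.1 h
  exact ⟨U, h1.1, r₀, fun q hq r hr => h2 ⟨hq, hr⟩⟩

/-- The limit at null infinity of a function whose derivative in the direction `v` tends to zero
is constant in the direction `v`. -/
lemma limit_eq_of_tendsto_fderiv {F : Coord → ℝ} {L : Scri → ℝ} (hF : DifferentiableOn ℝ F D.dom)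
    {v : Scri}
    (hv : ∀ p ∈ D.scri, Tendsto (fun x => fderiv ℝ F x (pt 0 v)) (nearScri p) (𝓝 0))
    (hL : ∀ p ∈ D.scri, Tendsto F (nearScri p) (𝓝 (L p))) {q : Scri} (hq : q ∈ D.scri)
    (hqv : q + v ∈ D.scri) : L (q + v) = L q := by
  have hseg : ∀ t ∈ Set.Icc (0 : ℝ) 1, q + t • v ∈ D.scri := fun t ht => by
    have := D.convex_scri hq hqv (sub_nonneg.2 ht.2) ht.1 (by ring)
    convert this using 1
    module
  -- L is known only as a limit, so it is not differentiated directly. At fixed large r the mean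
  -- value inequality bounds increments of F by ε |t' - t| with the same neighbourhood for all r,
  -- and the bound survives r → ∞.
  have hd : ∀ t ∈ Set.Icc (0 : ℝ) 1, HasDerivAt (fun t : ℝ => L (q + t • v)) 0 t := by
    intro t ht
    rw [hasDerivAt_iff_isLittleO, isLittleO_iff]
    intro ε hε
    have h1 := (Metric.tendsto_nhds.1 (hv _ (hseg t ht)) ε hε).and
      (Region.eventually_dom (hseg t ht))
    obtain ⟨U, hU, r₀, hUr⟩ := exists_of_eventually_nearScri h1
    have hc : ContinuousAt (fun t : ℝ => q + t • v) t := by fun_prop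
    obtain ⟨δ, hδ, hball⟩ := Metric.mem_nhds_iff.1
      (hc.preimage_mem_nhds (Filter.inter_mem hU (D.isOpen_scri.mem_nhds (hseg t ht))))
    filter_upwards [Metric.ball_mem_nhds t hδ] with t' ht'
    have hlim := ((hL _ (hball ht').2).comp (tendsto_pt _)).sub
      ((hL _ (hseg t ht)).comp (tendsto_pt _))
    rw [smul_zero, sub_zero]
    refine le_of_tendsto hlim.norm ?_
    filter_upwards [eventually_ge_atTop r₀] with r hr
    refine Convex.norm_image_sub_le_of_norm_hasDerivWithin_le
      (f := fun t => F (pt r (q + t • v))) (f' := fun t => fderiv ℝ F (pt r (q + t • v)) (pt 0 v))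
      (fun y hy => ?_) (fun y hy => ?_) (convex_ball t δ) (Metric.mem_ball_self hδ) ht'
    · have h2 := (hUr _ (hball hy).1 r hr).2
      simpa using (hasDerivAt_line (F := F) (r := r) (s := 0) (t := y) (q := q) (v := v)
        (by simpa using differentiableAt_of_mem_dom hF h2)).hasDerivWithinAt
    · have := (hUr _ (hball hy).1 r hr).1
      rw [dist_zero_right] at this
      exact this.le
  have := constant_of_has_deriv_right_zero (f := fun t : ℝ => L (q + t • v)) (a := 0) (b := 1)
    (fun t ht => (hd t ht).continuousAt.continuousWithinAt)
    (fun t ht => (hd t ⟨ht.1, ht.2.le⟩).hasDerivWithinAt) 1 (by simp)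
  simpa using this

/-- Limits of the solution of a 2 × 2 linear system. -/
lemma tendsto_of_linear_system {X : Type*} {l : Filter X} {A B D x y f g : X → ℝ} {d f₀ g₀ : ℝ}
    (hA : Tendsto A l (𝓝 (-1))) (hB : Tendsto B l (𝓝 0)) (hD : Tendsto D l (𝓝 (-d))) (hd : d ≠ 0)
    (hf : Tendsto f l (𝓝 f₀)) (hg : Tendsto g l (𝓝 g₀))
    (h1 : ∀ᶠ z in l, A z * x z + B z * y z = f z)
    (h2 : ∀ᶠ z in l, B z * x z + D z * y z = g z) :
    Tendsto x l (𝓝 (-f₀)) ∧ Tendsto y l (𝓝 (-g₀ / d)) := by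
  -- Cramer's rule. The limit matrix diag(-1, -d) is the form taken by the angular metric divided by
  -- r², with d = sin² θ.
  have hdet : Tendsto (fun z => A z * D z - B z * B z) l (𝓝 d) := by
    have := (hA.mul hD).sub (hB.mul hB)
    convert this using 2
    ring
  have hne := hdet.eventually_ne hd
  constructor
  · have h := ((hf.mul hD).sub (hB.mul hg)).div hdet hd
    rw [show (f₀ * -d - 0 * g₀) / d = -f₀ by field_simp; ring] at h
    refine h.congr' ?_
    filter_upwards [h1, h2, hne] with z e1 e2 e3
    simp only [Pi.div_apply]
    rw [div_eq_iff e3]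
    rw [← e1, ← e2]; ring
  · have h := ((hA.mul hg).sub (hB.mul hf)).div hdet hd
    rw [show (-1 * g₀ - 0 * f₀) / d = -g₀ / d by ring] at h
    refine h.congr' ?_
    filter_upwards [h1, h2, hne] with z e1 e2 e3
    simp only [Pi.div_apply]
    rw [div_eq_iff e3]
    rw [← e1, ← e2]; ring

end Lines

/-! ### The metric near null infinity -/

section Metric

variable (S : Spacetime)

/-- The area `Re ξ^θ Im ξ^φ - Im ξ^θ Re ξ^φ` spanned by the real and imaginary parts of `m`. -/
def tetradDet (x : Coord) : ℝ := (S.Xθ x).re * (S.Xφ x).im - (S.Xθ x).im * (S.Xφ x).re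

variable {S} {x : Coord}

/-- The relations for m say that Re m and Im m are orthogonal with square -1/2. Inverting this
change of frame yields the angular block. -/
lemma metric_angular (hx : x ∈ S.dom) :
    tetradDet S x ≠ 0 ∧
    S.g x 2 2 = -((S.Xφ x).re * (S.Xφ x).re + (S.Xφ x).im * (S.Xφ x).im) *
      (2 * (tetradDet S x * tetradDet S x))⁻¹ ∧
    S.g x 2 3 = ((S.Xθ x).re * (S.Xφ x).re + (S.Xθ x).im * (S.Xφ x).im) *
      (2 * (tetradDet S x * tetradDet S x))⁻¹ ∧
    S.g x 3 3 = -((S.Xθ x).re * (S.Xθ x).re + (S.Xθ x).im * (S.Xθ x).im) *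
      (2 * (tetradDet S x * tetradDet S x))⁻¹ := by
  have h1 := S.mm x hx
  have h2 := S.mm_bar x hx
  have hs := S.g_symm x hx 3 2
  simp only [cdot, mVec, Fin.sum_univ_four, Complex.ext_iff] at h1 h2
  simp [hs] at h1 h2
  obtain ⟨h1r, h1i⟩ := h1
  obtain ⟨h2r, -⟩ := h2
  have hpp : S.g x 2 2 * (S.Xθ x).re ^ 2 + 2 * S.g x 2 3 * (S.Xθ x).re * (S.Xφ x).re
      + S.g x 3 3 * (S.Xφ x).re ^ 2 = -1 / 2 := by linear_combination (h1r + h2r) / 2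
  have hqq : S.g x 2 2 * (S.Xθ x).im ^ 2 + 2 * S.g x 2 3 * (S.Xθ x).im * (S.Xφ x).im
      + S.g x 3 3 * (S.Xφ x).im ^ 2 = -1 / 2 := by linear_combination (h2r - h1r) / 2
  have hpq : S.g x 2 2 * (S.Xθ x).re * (S.Xθ x).im
      + S.g x 2 3 * ((S.Xθ x).re * (S.Xφ x).im + (S.Xθ x).im * (S.Xφ x).re)
      + S.g x 3 3 * (S.Xφ x).re * (S.Xφ x).im = 0 := by linear_combination h1i / 2
  have e22 : S.g x 2 2 * tetradDet S x ^ 2 = -((S.Xφ x).re ^ 2 + (S.Xφ x).im ^ 2) / 2 := by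
    rw [tetradDet]
    linear_combination (S.Xφ x).im ^ 2 * hpp + (S.Xφ x).re ^ 2 * hqq
      - 2 * (S.Xφ x).re * (S.Xφ x).im * hpq
  have e33 : S.g x 3 3 * tetradDet S x ^ 2 = -((S.Xθ x).re ^ 2 + (S.Xθ x).im ^ 2) / 2 := by
    rw [tetradDet]
    linear_combination (S.Xθ x).im ^ 2 * hpp + (S.Xθ x).re ^ 2 * hqq
      - 2 * (S.Xθ x).re * (S.Xθ x).im * hpq
  have e23 : S.g x 2 3 * tetradDet S x ^ 2 =
      ((S.Xθ x).re * (S.Xφ x).re + (S.Xθ x).im * (S.Xφ x).im) / 2 := by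
    rw [tetradDet]
    linear_combination -(S.Xθ x).im * (S.Xφ x).im * hpp - (S.Xθ x).re * (S.Xφ x).re * hqq
      + ((S.Xθ x).re * (S.Xφ x).im + (S.Xθ x).im * (S.Xφ x).re) * hpq
  have hdet : tetradDet S x ≠ 0 := by
    intro h0
    -- Gram determinant of Re m and Im m, equal to (-1/2)² - 0; it excludes a degenerate frame.
    have : (S.g x 2 2 * S.g x 3 3 - S.g x 2 3 ^ 2) * tetradDet S x ^ 2 = 1 / 4 := by
      rw [tetradDet]
      linear_combination (S.g x 2 2 * (S.Xθ x).im ^ 2 + 2 * S.g x 2 3 * (S.Xθ x).im * (S.Xφ x).im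
        + S.g x 3 3 * (S.Xφ x).im ^ 2) * hpp - 1 / 2 * hqq - (S.g x 2 2 * (S.Xθ x).re * (S.Xθ x).im
        + S.g x 2 3 * ((S.Xθ x).re * (S.Xφ x).im + (S.Xθ x).im * (S.Xφ x).re)
        + S.g x 3 3 * (S.Xφ x).re * (S.Xφ x).im) * hpq
    rw [h0] at this
    norm_num at this
  refine ⟨hdet, ?_, ?_, ?_⟩
  · rw [eq_mul_inv_iff_mul_eq₀ (by positivity)]; linear_combination 2 * e22
  · rw [eq_mul_inv_iff_mul_eq₀ (by positivity)]; linear_combination 2 * e23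
  · rw [eq_mul_inv_iff_mul_eq₀ (by positivity)]; linear_combination 2 * e33

/-- Re m and Im m span the angular directions, so a real angular covector annihilating m is zero. -/
lemma eq_zero_of_tetrad (hx : x ∈ S.dom) {v w : ℝ}
    (h : (v : ℂ) * S.Xθ x + w * S.Xφ x = 0) : v = 0 ∧ w = 0 := by
  have hd := (metric_angular hx).1
  simp only [Complex.ext_iff] at h
  simp at h
  constructor
  · refine (mul_eq_zero.1 ?_).resolve_right hd
    rw [tetradDet]; linear_combination (S.Xφ x).im * h.1 - (S.Xφ x).re * h.2
  · refine (mul_eq_zero.1 ?_).resolve_right hd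
    rw [tetradDet]; linear_combination (S.Xθ x).re * h.2 - (S.Xθ x).im * h.1

lemma metric_11 (hx : x ∈ S.dom) : S.g x 1 1 = 0 := by
  have := S.ll x hx
  simpa [cdot, lVec, Fin.sum_univ_four] using this

lemma metric_12_13 (hx : x ∈ S.dom) : S.g x 1 2 = 0 ∧ S.g x 1 3 = 0 := by
  have := S.lm x hx
  simp [cdot, lVec, mVec, Fin.sum_univ_four] at this
  exact eq_zero_of_tetrad hx this

lemma metric_01 (hx : x ∈ S.dom) : S.g x 0 1 = 1 := by
  have := S.ln x hx
  simp [cdot, lVec, nVec, Fin.sum_univ_four, metric_11 hx, metric_12_13 hx] at this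
  rw [S.g_symm x hx]
  exact_mod_cast this

lemma metric_02_03 (hx : x ∈ S.dom) :
    S.g x 0 2 = -(S.Cθ x * S.g x 2 2 + S.Cφ x * S.g x 2 3) ∧
    S.g x 0 3 = -(S.Cθ x * S.g x 2 3 + S.Cφ x * S.g x 3 3) := by
  have h := S.nm x hx
  simp [cdot, nVec, mVec, Fin.sum_univ_four, metric_12_13 hx, S.g_symm x hx 3 2] at h
  have := eq_zero_of_tetrad hx (v := S.g x 0 2 + (S.Cθ x * S.g x 2 2 + S.Cφ x * S.g x 2 3))
    (w := S.g x 0 3 + (S.Cθ x * S.g x 2 3 + S.Cφ x * S.g x 3 3))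
    (by push_cast; linear_combination h)
  constructor <;> linarith [this.1, this.2]

lemma metric_00 (hx : x ∈ S.dom) :
    S.g x 0 0 = -2 * S.Q x - S.Cθ x * S.g x 0 2 - S.Cφ x * S.g x 0 3 := by
  have h := S.nn x hx
  have h1 := metric_02_03 hx
  simp [cdot, nVec, Fin.sum_univ_four, metric_11 hx, metric_12_13 hx, S.g_symm x hx 3 2,
    S.g_symm x hx 1 0, metric_01 hx, S.g_symm x hx 2 0, S.g_symm x hx 3 0,
    S.g_symm x hx 2 1, S.g_symm x hx 3 1] at h
  have h' : (S.g x 0 0 + S.Q x + S.Cθ x * S.g x 0 2 + S.Cφ x * S.g x 0 3 + S.Q x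
     + S.Cθ x * (S.g x 0 2 + S.Cθ x * S.g x 2 2 + S.Cφ x * S.g x 2 3)
     + S.Cφ x * (S.g x 0 3 + S.Cθ x * S.g x 2 3 + S.Cφ x * S.g x 3 3)) = 0 := by
    have : ((S.g x 0 0 + S.Q x + S.Cθ x * S.g x 0 2 + S.Cφ x * S.g x 0 3 + S.Q x
     + S.Cθ x * (S.g x 0 2 + S.Cθ x * S.g x 2 2 + S.Cφ x * S.g x 2 3)
     + S.Cφ x * (S.g x 0 3 + S.Cθ x * S.g x 2 3 + S.Cφ x * S.g x 3 3) : ℝ) : ℂ) = 0 := by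
      push_cast; linear_combination h
    exact_mod_cast this
  linear_combination h' - S.Cθ x * h1.1 - S.Cφ x * h1.2

variable {p : Scri}

lemma eventually_differentiableAt {E : Type*} [NormedAddCommGroup E] [NormedSpace ℝ E]
    {D : Region} {f : Coord → E} (hf : IsSmoothPeriodic D f) (hp : p ∈ D.scri) :
    ∀ᶠ x in nearScri p, DifferentiableAt ℝ f x :=
  (Region.eventually_dom hp).mono fun _ hx =>
    differentiableAt_of_mem_dom (hf.smooth.differentiableOn (by simp)) hx

lemma IsSmoothPeriodic.ofReal {D : Region} {f : Coord → ℝ} (hf : IsSmoothPeriodic D f) :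
    IsSmoothPeriodic D (fun x => (f x : ℂ)) :=
  ⟨Complex.ofRealCLM.contDiff.comp_contDiffOn hf.smooth, fun x hx => by rw [hf.periodic x hx]⟩

lemma lead_zero_of_real {D : Region} {f : Coord → ℝ} (hf : IsSmoothPeriodic D f) {k : ℤ}
    {coef : ℤ → Scri → Polynomial ℂ} (h : HasPolyhomExpansion D (fun x => (f x : ℂ)) k coef)
    (hp : p ∈ D.scri) : Lead p f (1 - k) 0 0 0 := by
  simpa using (h.lead_zero (eventually_differentiableAt hf.ofReal hp) hp).clm Complex.reCLM

lemma lead_Cθ (hp : p ∈ S.scri) : Lead p S.Cθ (-1) 0 0 0 := by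
  obtain ⟨coef, h⟩ := S.Cθ_exp
  exact lead_zero_of_real S.Cθ_reg h hp

lemma lead_Cφ (hp : p ∈ S.scri) : Lead p S.Cφ (-1) 0 0 0 := by
  obtain ⟨coef, h⟩ := S.Cφ_exp
  exact lead_zero_of_real S.Cφ_reg h hp

/-- The precision o(r) suffices for g_uu = o(r²) and for replacing ξ^r by a at order r. -/
lemma lead_Q (hp : p ∈ S.scri) : Lead p S.Q 1 0 0 0 := by
  obtain ⟨coef, h, -⟩ := S.Q_exp
  exact lead_zero_of_real S.Q_reg h hp

lemma lead_Xθ (hp : p ∈ S.scri) :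
    Lead p (fun x => (S.Xθ x).re) (-1) (1 / √2) 0 0 ∧ Lead p (fun x => (S.Xθ x).im) (-1) 0 0 0 := by
  obtain ⟨coef, h, h1⟩ := S.Xθ_exp
  have hX := h.lead (eventually_differentiableAt S.Xθ_reg hp) hp h1
  have e : (1 / (√2 : ℂ)) = ((1 / √2 : ℝ) : ℂ) := by push_cast; rfl
  rw [e] at hX
  constructor
  · exact (hX.clm Complex.reCLM).of_eq rfl (by simp only [Complex.reCLM_apply, Complex.ofReal_re])
      (by simp) (by simp)
  · exact (hX.clm Complex.imCLM).of_eq rfl (by simp only [Complex.imCLM_apply, Complex.ofReal_im])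
      (by simp) (by simp)

lemma hasFDerivAt_inv_sin (hp : Real.sin p.2.1 ≠ 0) :
    HasFDerivAt (fun q : Scri => -Complex.I / ((√2 : ℂ) * (Real.sin q.2.1 : ℂ)))
      (((ContinuousLinearMap.fst ℝ ℝ ℝ).comp (ContinuousLinearMap.snd ℝ ℝ (ℝ × ℝ))).smulRight
        (((Real.cos p.2.1 / (√2 * Real.sin p.2.1 ^ 2) : ℝ) : ℂ) * Complex.I)) p := by
  have h1 : HasDerivAt (fun θ : ℝ => -((√2)⁻¹ * (Real.sin θ)⁻¹))
      (Real.cos p.2.1 / (√2 * Real.sin p.2.1 ^ 2)) p.2.1 := by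
    refine (((Real.hasDerivAt_sin p.2.1).inv hp).const_mul (√2)⁻¹).neg.congr_deriv ?_
    field_simp
  have h3 : HasFDerivAt (fun q : Scri => q.2.1)
      ((ContinuousLinearMap.fst ℝ ℝ ℝ).comp (ContinuousLinearMap.snd ℝ ℝ (ℝ × ℝ))) p :=
    ((ContinuousLinearMap.fst ℝ ℝ ℝ).comp (ContinuousLinearMap.snd ℝ ℝ (ℝ × ℝ))).hasFDerivAt
  have h2 := (h1.ofReal_comp.mul_const Complex.I).hasFDerivAt.comp p h3
  refine (h2.congr_fderiv ?_).congr_of_eventuallyEq (Eventually.of_forall fun q => ?_)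
  · ext <;> simp
  · simp [div_eq_mul_inv, mul_comm]

lemma lead_Xφ (hp : p ∈ S.scri) :
    Lead p (fun x => (S.Xφ x).re) (-1) 0 0 0 ∧
    Lead p (fun x => (S.Xφ x).im) (-1) (-(1 / (√2 * Real.sin p.2.1))) 0
      (Real.cos p.2.1 / (√2 * Real.sin p.2.1 ^ 2)) := by
  obtain ⟨coef, h, h1⟩ := S.Xφ_exp
  have hs : Real.sin p.2.1 ≠ 0 := (Real.sin_pos_of_mem_Ioo hp.2).ne'
  have hX := h.lead (eventually_differentiableAt S.Xφ_reg hp) hp h1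
  have e : -Complex.I / ((√2 : ℂ) * (Real.sin p.2.1 : ℂ)) =
      ((-(1 / (√2 * Real.sin p.2.1)) : ℝ) : ℂ) * Complex.I := by
    push_cast; ring
  rw [(hasFDerivAt_inv_sin hs).fderiv, e] at hX
  constructor
  · refine (hX.clm Complex.reCLM).of_eq rfl ?_ ?_ ?_
    · rw [Complex.reCLM_apply, Complex.re_ofReal_mul]; simp
    · simp
    · simp only [ContinuousLinearMap.smulRight_apply, Complex.reCLM_apply, Complex.smul_re,
        Complex.re_ofReal_mul]; simp
  · refine (hX.clm Complex.imCLM).of_eq rfl ?_ ?_ ?_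
    · rw [Complex.imCLM_apply, Complex.im_ofReal_mul]; simp
    · simp
    · simp only [ContinuousLinearMap.smulRight_apply, Complex.imCLM_apply, Complex.smul_im,
        Complex.im_ofReal_mul]; simp

lemma lead_inv_det (hp : p ∈ S.scri) :
    Lead p (fun x => (2 * (tetradDet S x * tetradDet S x))⁻¹) 4 (2 * Real.sin p.2.1 ^ 2) 0
      (4 * Real.sin p.2.1 * Real.cos p.2.1) := by
  have hs : Real.sin p.2.1 ≠ 0 := (Real.sin_pos_of_mem_Ioo hp.2).ne'
  have h2 : √2 ^ 2 = 2 := Real.sq_sqrt (by norm_num)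
  have h0 : √2 ≠ 0 := by positivity
  have hd : Lead p (tetradDet S) (-2) (-(1 / (2 * Real.sin p.2.1))) 0
      (Real.cos p.2.1 / (2 * Real.sin p.2.1 ^ 2)) := by
    refine (((lead_Xθ hp).1.mul (lead_Xφ hp).2).sub ((lead_Xθ hp).2.mul (lead_Xφ hp).1)).of_eq
      rfl ?_ ?_ ?_
    · field_simp; rw [h2]; ring
    · simp
    · field_simp; rw [h2]; ring
  have h3 := ((hd.mul hd).clm ((2 : ℝ) • ContinuousLinearMap.id ℝ ℝ)).inv (by
    simp [hs])
  refine h3.of_eq (by norm_num) ?_ ?_ ?_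
  · simp; field_simp
  · simp
  · simp; field_simp; ring

lemma lead_g22 (hp : p ∈ S.scri) : Lead p (fun x => S.g x 2 2) 2 (-1) 0 0 := by
  have hs : Real.sin p.2.1 ≠ 0 := (Real.sin_pos_of_mem_Ioo hp.2).ne'
  have h2 : √2 ^ 2 = 2 := Real.sq_sqrt (by norm_num)
  have h0 : √2 ≠ 0 := by positivity
  have hφ := lead_Xφ hp
  refine (((((hφ.1.mul hφ.1).add (hφ.2.mul hφ.2)).neg).mul (lead_inv_det hp)).of_eq
    (by norm_num) ?_ ?_ ?_).congr hp fun x hx _ => (metric_angular hx).2.1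
  · field_simp; rw [h2]; ring
  · simp
  · field_simp; rw [h2]; ring

lemma lead_g33 (hp : p ∈ S.scri) : Lead p (fun x => S.g x 3 3) 2 (-Real.sin p.2.1 ^ 2) 0
    (-2 * Real.sin p.2.1 * Real.cos p.2.1) := by
  have h2 : √2 ^ 2 = 2 := Real.sq_sqrt (by norm_num)
  have h0 : √2 ≠ 0 := by positivity
  have hθ := lead_Xθ hp
  refine (((((hθ.1.mul hθ.1).add (hθ.2.mul hθ.2)).neg).mul (lead_inv_det hp)).of_eq
    (by norm_num) ?_ ?_ ?_).congr hp fun x hx _ => (metric_angular hx).2.2.2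
  · field_simp; rw [h2]; ring
  · simp
  · field_simp; rw [h2]; ring

lemma lead_g23 (hp : p ∈ S.scri) : Lead p (fun x => S.g x 2 3) 2 0 0 0 := by
  have hθ := lead_Xθ hp
  have hφ := lead_Xφ hp
  refine ((((hθ.1.mul hφ.1).add (hθ.2.mul hφ.2)).mul (lead_inv_det hp)).of_eq
    (by norm_num) ?_ ?_ ?_).congr hp fun x hx _ => (metric_angular hx).2.2.1
  all_goals simp

lemma lead_g02 (hp : p ∈ S.scri) : Lead p (fun x => S.g x 0 2) 1 0 0 0 := by
  refine ((((lead_Cθ hp).mul (lead_g22 hp)).add ((lead_Cφ hp).mul (lead_g23 hp))).neg.of_eq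
    (by norm_num) ?_ ?_ ?_).congr hp fun x hx _ => (metric_02_03 hx).1
  all_goals simp

lemma lead_g03 (hp : p ∈ S.scri) : Lead p (fun x => S.g x 0 3) 1 0 0 0 := by
  refine ((((lead_Cθ hp).mul (lead_g23 hp)).add ((lead_Cφ hp).mul (lead_g33 hp))).neg.of_eq
    (by norm_num) ?_ ?_ ?_).congr hp fun x hx _ => (metric_02_03 hx).2
  all_goals simp

lemma Lead.tendsto_smaller {f : Coord → ℝ} {k : ℤ} {L Lu Lθ : ℝ} (h : Lead p f k L Lu Lθ)
    {j : ℤ} (hj : k < j) : Tendsto (fun x => (x 1) ^ (-j) * f x) (nearScri p) (𝓝 0) := by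
  have h1 : Tendsto (fun r : ℝ => r ^ (k - j)) atTop (𝓝 0) :=
    tendsto_zpow_atTop_zero (by omega)
  have := (h1.comp (tendsto_radius p)).mul h.val
  rw [zero_mul] at this
  refine this.congr' ?_
  filter_upwards [eventually_radius_pos p] with x hx
  rw [Function.comp, smul_eq_mul, ← mul_assoc, ← zpow_add₀ hx.ne']
  congr 2; ring

lemma tendsto_g00 (hp : p ∈ S.scri) :
    Tendsto (fun x => (x 1) ^ (-2 : ℤ) * S.g x 0 0) (nearScri p) (𝓝 0) := by
  have h1 := (lead_Q hp).tendsto_smaller (show (1 : ℤ) < 2 by norm_num)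
  have h2 := ((lead_Cθ hp).mul (lead_g02 hp)).tendsto_smaller (show (-1 + 1 : ℤ) < 2 by norm_num)
  have h3 := ((lead_Cφ hp).mul (lead_g03 hp)).tendsto_smaller (show (-1 + 1 : ℤ) < 2 by norm_num)
  have := ((h1.const_mul (-2)).sub h2).sub h3
  simp only [mul_zero, sub_zero] at this
  refine this.congr' ?_
  filter_upwards [Region.eventually_dom hp] with x hx
  rw [metric_00 hx]
  ring

end Metric

/-! ### Killing fields commuting with the axial Killing field -/

lemma axial_eq (x : Coord) : axial x = Pi.single 3 1 := by
  ext i; fin_cases i <;> simp [axial]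

lemma pd_apply {V : Coord → Coord} {x : Coord} (h : DifferentiableAt ℝ V x) (μ ν : Fin 4) :
    pd ν (fun y => V y μ) x = fderiv ℝ V x (Pi.single ν 1) μ := by
  have := (hasFDerivAt_pi'.1 h.hasFDerivAt μ).fderiv
  rw [pd, this]; rfl

lemma lieBracket_axial (V : Coord → Coord) (x : Coord) :
    VectorField.lieBracket ℝ axial V x = fderiv ℝ V x (Pi.single 3 1) := by
  have : fderiv ℝ axial x = 0 := by
    have h : axial = fun _ => ![0, 0, 0, 1] := rfl
    rw [h]; simp
  rw [VectorField.lieBracket, this, axial_eq]; simp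

/-- A vector field on the domain, periodic in `φ`, whose bracket with `∂_φ` is a linear combination
of `∂_φ` and itself commutes with `∂_φ`. -/
lemma lieBracket_axial_eq_zero {D : Region} {V : Coord → Coord} (hV : IsSmoothPeriodic D V)
    {s t : ℝ} (h : ∀ x ∈ D.dom, VectorField.lieBracket ℝ axial V x = s • axial x + t • V x) :
    ∀ x ∈ D.dom, VectorField.lieBracket ℝ axial V x = 0 := by
  intro x hx
  have hpt : ∀ y : ℝ, pt (x 1) (x 0, x 2, y) ∈ D.dom := fun y => ⟨hx.1, hx.2.1, hx.2.2⟩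
  have hxy : x = pt (x 1) (x 0, x 2, x 3) := (pt_toScri x).symm
  -- Because ∂_φ has constant components, the bracket hypothesis is a scalar linear equation for
  -- each component along the φ-circle.
  have hd : ∀ μ y, HasDerivAt (fun y => V (pt (x 1) (x 0, x 2, y)) μ)
      (s * axial x μ + t * V (pt (x 1) (x 0, x 2, y)) μ) y := by
    intro μ y
    have hdiff := differentiableAt_of_mem_dom (hV.smooth.differentiableOn (by simp)) (hpt y)
    have h1 := hasDerivAt_line (F := V) (r := x 1) (s := 0) (t := y) (q := (x 0, x 2, 0))
      (v := (0, 0, 1)) (by simpa using hdiff)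
    have h2 : pt 0 (0, 0, 1) = Pi.single 3 1 := by ext i; fin_cases i <;> simp [pt]
    simp only [mul_zero, add_zero, h2, Prod.smul_mk, smul_eq_mul, mul_one, Prod.mk_add_mk,
      zero_add, ← lieBracket_axial, h _ (hpt y)] at h1
    exact hasDerivAt_pi.1 h1 μ
  ext μ
  rw [h x hx]
  have h3 := eq_zero_of_periodic_of_hasDerivAt (hd μ) (fun y => by
    have h4 := hV.periodic _ (hpt y)
    have h5 : turn (pt (x 1) (x 0, x 2, y)) = pt (x 1) (x 0, x 2, y + 2 * Real.pi) := by
      ext i; fin_cases i <;> simp [turn, pt]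
    rw [← h5, h4]) (x 3)
  rw [← hxy] at h3
  simpa using h3

/-- A Killing vector field of an axisymmetric spacetime that commutes with `∂_φ`. -/
structure IsInvariantKilling (S : Spacetime) (V : Coord → Coord) : Prop where
  axisymmetric : IsAxisymmetric S
  killing : IsKilling S V
  invariant : ∀ x ∈ S.dom, ∀ μ, pd 3 (fun y => V y μ) x = 0

namespace IsInvariantKilling

variable {S : Spacetime} {V : Coord → Coord}

lemma differentiableOn (h : IsInvariantKilling S V) : DifferentiableOn ℝ V S.dom :=
  h.killing.reg.smooth.differentiableOn (by simp)

lemma contDiffOn_apply (h : IsInvariantKilling S V) (μ : Fin 4) :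
    ContDiffOn ℝ ∞ (fun y => V y μ) S.dom :=
  contDiffOn_pi.1 h.killing.reg.smooth μ

lemma differentiableOn_apply (h : IsInvariantKilling S V) (μ : Fin 4) :
    DifferentiableOn ℝ (fun y => V y μ) S.dom :=
  (h.contDiffOn_apply μ).differentiableOn (by simp)

end IsInvariantKilling

lemma pd_const (c : ℝ) (μ : Fin 4) (x : Coord) : pd μ (fun _ => c) x = 0 := by
  simp [pd]

lemma IsAxisymmetric.pd_metric {S : Spacetime} (hS : IsAxisymmetric S) {x : Coord}
    (hx : x ∈ S.dom) (μ ν : Fin 4) : pd 3 (fun y => S.g y μ ν) x = 0 := by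
  have := hS.killing x hx μ ν
  simpa [Fin.sum_univ_four, axial, pd_const] using this

/-! ### Components of the Killing equation -/

namespace IsInvariantKilling

variable {S : Spacetime} {V : Coord → Coord} {x : Coord} {p : Scri}

lemma equation (h : IsInvariantKilling S V) (hx : x ∈ S.dom) (μ ν : Fin 4) :
    V x 0 * pd 0 (fun y => S.g y μ ν) x + V x 1 * pd 1 (fun y => S.g y μ ν) x
      + V x 2 * pd 2 (fun y => S.g y μ ν) x
      + (S.g x 0 ν * pd μ (fun y => V y 0) x + S.g x 1 ν * pd μ (fun y => V y 1) x
        + S.g x 2 ν * pd μ (fun y => V y 2) x + S.g x 3 ν * pd μ (fun y => V y 3) x)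
      + (S.g x μ 0 * pd ν (fun y => V y 0) x + S.g x μ 1 * pd ν (fun y => V y 1) x
        + S.g x μ 2 * pd ν (fun y => V y 2) x + S.g x μ 3 * pd ν (fun y => V y 3) x) = 0 := by
  have h1 := h.killing.killing x hx μ ν
  rw [Fin.sum_univ_four, h.axisymmetric.pd_metric hx] at h1
  linear_combination h1

/-- The metric row of index r is exactly (1, 0, 0, 0), so equations with an index r contain no
derivative of the metric. -/
lemma equation_11 (h : IsInvariantKilling S V) (hx : x ∈ S.dom) :
    pd 1 (fun y => V y 0) x = 0 := by
  have e := h.equation hx 1 1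
  have h11 : ∀ s, pd s (fun y => S.g y 1 1) x = 0 := fun s => by
    rw [pd_congr (fun y hy => metric_11 hy) s hx, pd_const]
  simp only [h11, S.g_symm x hx 1 0, S.g_symm x hx 2 1, S.g_symm x hx 3 1, metric_01 hx,
    metric_11 hx, (metric_12_13 hx).1, (metric_12_13 hx).2] at e
  linarith

lemma equation_12 (h : IsInvariantKilling S V) (hx : x ∈ S.dom) :
    S.g x 2 2 * pd 1 (fun y => V y 2) x + S.g x 2 3 * pd 1 (fun y => V y 3) x
      = -pd 2 (fun y => V y 0) x := by
  have e := h.equation hx 1 2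
  have h12 : ∀ s, pd s (fun y => S.g y 1 2) x = 0 := fun s => by
    rw [pd_congr (fun y hy => (metric_12_13 hy).1) s hx, pd_const]
  simp only [h12, S.g_symm x hx 1 0, S.g_symm x hx 3 2, metric_01 hx, h.equation_11 hx,
    metric_11 hx, (metric_12_13 hx).1, (metric_12_13 hx).2] at e
  linarith

lemma equation_13 (h : IsInvariantKilling S V) (hx : x ∈ S.dom) :
    S.g x 2 3 * pd 1 (fun y => V y 2) x + S.g x 3 3 * pd 1 (fun y => V y 3) x = 0 := by
  have e := h.equation hx 1 3
  have h13 : ∀ s, pd s (fun y => S.g y 1 3) x = 0 := fun s => by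
    rw [pd_congr (fun y hy => (metric_12_13 hy).2) s hx, pd_const]
  simp only [h13, h.equation_11 hx, h.invariant x hx,
    metric_11 hx, (metric_12_13 hx).1, (metric_12_13 hx).2] at e
  linarith

/-- Controls radial growth: the angular terms are o(r) · O(r⁻²), leaving ∂_r ξ^r → -∂_u ξ^u. -/
lemma equation_01 (h : IsInvariantKilling S V) (hx : x ∈ S.dom) :
    pd 0 (fun y => V y 0) x + pd 1 (fun y => V y 1) x + S.g x 0 2 * pd 1 (fun y => V y 2) x
      + S.g x 0 3 * pd 1 (fun y => V y 3) x = 0 := by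
  have e := h.equation hx 0 1
  have h01 : ∀ s, pd s (fun y => S.g y 0 1) x = 0 := fun s => by
    rw [pd_congr (fun y hy => metric_01 hy) s hx, pd_const]
  simp only [h01, metric_01 hx, h.equation_11 hx, S.g_symm x hx 2 1, S.g_symm x hx 3 1,
    metric_11 hx, (metric_12_13 hx).1, (metric_12_13 hx).2] at e
  linarith

/-- The action of an invariant vector field on an axisymmetric function. -/
def transport (V : Coord → Coord) (G : Coord → ℝ) (x : Coord) : ℝ :=
  V x 0 * pd 0 G x + V x 1 * pd 1 G x + V x 2 * pd 2 G x

lemma equation_33 (h : IsInvariantKilling S V) (hx : x ∈ S.dom) :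
    transport V (fun y => S.g y 3 3) x = 0 := by
  have e := h.equation hx 3 3
  simp only [h.invariant x hx] at e
  rw [transport]; linarith

lemma equation_22 (h : IsInvariantKilling S V) (hx : x ∈ S.dom) :
    S.g x 2 2 * pd 2 (fun y => V y 2) x + S.g x 2 3 * pd 2 (fun y => V y 3) x =
      -(1 / 2) * transport V (fun y => S.g y 2 2) x - S.g x 0 2 * pd 2 (fun y => V y 0) x := by
  have e := h.equation hx 2 2
  simp only [S.g_symm x hx 2 0, S.g_symm x hx 3 2, S.g_symm x hx 2 1, (metric_12_13 hx).1] at e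
  rw [transport]; linarith

lemma equation_23 (h : IsInvariantKilling S V) (hx : x ∈ S.dom) :
    S.g x 2 3 * pd 2 (fun y => V y 2) x + S.g x 3 3 * pd 2 (fun y => V y 3) x =
      -transport V (fun y => S.g y 2 3) x - S.g x 0 3 * pd 2 (fun y => V y 0) x := by
  have e := h.equation hx 2 3
  simp only [h.invariant x hx, (metric_12_13 hx).2] at e
  rw [transport]; linarith

lemma equation_02 (h : IsInvariantKilling S V) (hx : x ∈ S.dom) :
    S.g x 2 2 * pd 0 (fun y => V y 2) x + S.g x 2 3 * pd 0 (fun y => V y 3) x =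
      -transport V (fun y => S.g y 0 2) x - S.g x 0 2 * pd 0 (fun y => V y 0) x
        - S.g x 0 0 * pd 2 (fun y => V y 0) x - pd 2 (fun y => V y 1) x
        - S.g x 0 2 * pd 2 (fun y => V y 2) x - S.g x 0 3 * pd 2 (fun y => V y 3) x := by
  have e := h.equation hx 0 2
  simp only [S.g_symm x hx 3 2, (metric_12_13 hx).1, metric_01 hx] at e
  rw [transport]; linarith

lemma equation_03 (h : IsInvariantKilling S V) (hx : x ∈ S.dom) :
    S.g x 2 3 * pd 0 (fun y => V y 2) x + S.g x 3 3 * pd 0 (fun y => V y 3) x =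
      -transport V (fun y => S.g y 0 3) x - S.g x 0 3 * pd 0 (fun y => V y 0) x := by
  have e := h.equation hx 0 3
  simp only [h.invariant x hx, (metric_12_13 hx).2] at e
  rw [transport]; linarith

/-! ### The field along the generators of null infinity -/

/-- A point of the domain on the generator `q`. -/
def _root_.NPKilling.Region.base (D : Region) (q : Scri) : Coord := pt (D.R (q.1, q.2.1) + 1) q

lemma radiallyConstant (h : IsInvariantKilling S V) :
    RadiallyConstant S.toRegion (fun y => V y 0) :=
  radiallyConstant_of_fderiv (h.differentiableOn_apply 0) fun _ hx => h.equation_11 hx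

lemma eq_base (h : IsInvariantKilling S V) (hx : x ∈ S.dom) :
    V x 0 = V (S.base (toScri x)) 0 := by
  conv_lhs => rw [← pt_toScri x]
  exact h.radiallyConstant _ (Region.mem_scri_of_mem_dom hx) _ hx.2.2 _ (lt_add_one _)

lemma radiallyConstant_pd (h : IsInvariantKilling S V) (μ : Fin 4) :
    RadiallyConstant S.toRegion (pd μ (fun y => V y 0)) := by
  intro q hq r hr r' hr'
  rw [pd, pd, h.radiallyConstant.fderiv q hq r hr r' hr']

lemma pd_eq_base (h : IsInvariantKilling S V) (hx : x ∈ S.dom) (μ : Fin 4) :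
    pd μ (fun y => V y 0) x = pd μ (fun y => V y 0) (S.base (toScri x)) := by
  conv_lhs => rw [← pt_toScri x]
  exact h.radiallyConstant_pd μ _ (Region.mem_scri_of_mem_dom hx) _ hx.2.2 _ (lt_add_one _)

lemma tendsto_pd (h : IsInvariantKilling S V) (hp : p ∈ S.scri) (μ : Fin 4) :
    Tendsto (pd μ (fun y => V y 0)) (nearScri p) (𝓝 (pd μ (fun y => V y 0) (S.base p))) := by
  refine (h.radiallyConstant_pd μ).tendsto ?_ hp (lt_add_one _)
  have := (h.contDiffOn_apply 0).continuousOn_fderiv_of_isOpen S.isOpen_dom (by simp)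
  exact this.clm_apply continuousOn_const

lemma lead_V0 (h : IsInvariantKilling S V) (hp : p ∈ S.scri) :
    Lead p (fun y => V y 0) 0 (V (S.base p) 0) (pd 0 (fun y => V y 0) (S.base p))
      (pd 2 (fun y => V y 0) (S.base p)) := by
  refine ⟨(Region.eventually_dom hp).mono fun x hx =>
    differentiableAt_of_mem_dom (h.differentiableOn_apply 0) hx, ?_, ?_, ?_, ?_⟩
  · simpa using! h.radiallyConstant.tendsto (h.differentiableOn_apply 0).continuousOn hp
      (lt_add_one _)
  · simpa using! h.tendsto_pd hp 0
  · simp only [Int.cast_zero, zero_smul]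
    refine tendsto_const_nhds.congr' ?_
    filter_upwards [Region.eventually_dom hp] with x hx
    have := h.equation_11 hx
    rw [pd] at this
    rw [this, smul_zero]
  · simpa using! h.tendsto_pd hp 2

lemma tendsto_V0 (h : IsInvariantKilling S V) (hp : p ∈ S.scri) :
    Tendsto (fun y => V y 0) (nearScri p) (𝓝 (V (S.base p) 0)) := by
  simpa using (h.lead_V0 hp).val

/-- The (rθ) and (rφ) equations form a linear system whose matrix is the angular metric, so
inverting it gains r⁻². -/
lemma tendsto_sq_mul_pd (h : IsInvariantKilling S V) (hp : p ∈ S.scri) :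
    Tendsto (fun x => (x 1) ^ 2 * pd 1 (fun y => V y 2) x) (nearScri p)
      (𝓝 (pd 2 (fun y => V y 0) (S.base p))) ∧
    Tendsto (fun x => (x 1) ^ 2 * pd 1 (fun y => V y 3) x) (nearScri p) (𝓝 0) := by
  have hs : Real.sin p.2.1 ≠ 0 := (Real.sin_pos_of_mem_Ioo hp.2).ne'
  have := tendsto_of_linear_system (lead_g22 hp).val (lead_g23 hp).val
    (lead_g33 hp).val (pow_ne_zero 2 hs) (h.tendsto_pd hp 2).neg
    (tendsto_const_nhds (x := (0 : ℝ)))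
    (x := fun x => (x 1) ^ 2 * pd 1 (fun y => V y 2) x)
    (y := fun x => (x 1) ^ 2 * pd 1 (fun y => V y 3) x) ?_ ?_
  · simpa using this
  · filter_upwards [Region.eventually_dom hp, eventually_radius_pos p] with x hx h0
    have : (x 1) ^ (-2 : ℤ) * (x 1) ^ 2 = 1 := by
      rw [zpow_neg]; norm_cast; field_simp
    rw [← h.equation_12 hx, smul_eq_mul, smul_eq_mul]
    linear_combination (S.g x 2 2 * pd 1 (fun y => V y 2) x
      + S.g x 2 3 * pd 1 (fun y => V y 3) x) * this
  · filter_upwards [Region.eventually_dom hp, eventually_radius_pos p] with x hx h0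
    have : (x 1) ^ (-2 : ℤ) * (x 1) ^ 2 = 1 := by
      rw [zpow_neg]; norm_cast; field_simp
    rw [← h.equation_13 hx, smul_eq_mul, smul_eq_mul]
    linear_combination (S.g x 2 3 * pd 1 (fun y => V y 2) x
      + S.g x 3 3 * pd 1 (fun y => V y 3) x) * this

lemma tendsto_pd_radial (h : IsInvariantKilling S V) (hp : p ∈ S.scri) :
    Tendsto (pd 1 (fun y => V y 1)) (nearScri p) (𝓝 (-pd 0 (fun y => V y 0) (S.base p))) := by
  have h1 := (lead_g02 hp).tendsto_smaller (show (1 : ℤ) < 2 by norm_num)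
  have h2 := (lead_g03 hp).tendsto_smaller (show (1 : ℤ) < 2 by norm_num)
  have h3 := h.tendsto_sq_mul_pd hp
  have := ((h.tendsto_pd hp 0).neg.sub (h1.mul h3.1)).sub (h2.mul h3.2)
  simp only [zero_mul, sub_zero] at this
  refine this.congr' ?_
  filter_upwards [Region.eventually_dom hp, eventually_radius_pos p] with x hx h0
  have e := h.equation_01 hx
  have : (x 1) ^ (-2 : ℤ) * (x 1) ^ 2 = 1 := by
    rw [zpow_neg]; norm_cast; field_simp
  linear_combination (-S.g x 0 2 * pd 1 (fun y => V y 2) x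
    - S.g x 0 3 * pd 1 (fun y => V y 3) x) * this - e

lemma eventually_hasDerivAt (h : IsInvariantKilling S V) (hp : p ∈ S.scri) (μ : Fin 4) :
    ∀ᶠ r in atTop, HasDerivAt (fun r => V (pt r p) μ) (pd 1 (fun y => V y μ) (pt r p)) r := by
  filter_upwards [(tendsto_pt p).eventually (Region.eventually_dom hp)] with r hr
  exact hasDerivAt_radial (F := fun y => V y μ)
    (differentiableAt_of_mem_dom (h.differentiableOn_apply μ) hr)

lemma tendsto_radial_component (h : IsInvariantKilling S V) (hp : p ∈ S.scri) :
    Tendsto (fun r => r⁻¹ * V (pt r p) 1) atTop (𝓝 (-pd 0 (fun y => V y 0) (S.base p))) :=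
  tendsto_div_of_tendsto_deriv (h.eventually_hasDerivAt hp 1)
    ((h.tendsto_pd_radial hp).comp (tendsto_pt p))

lemma isBigO_angular (h : IsInvariantKilling S V) (hp : p ∈ S.scri) :
    (fun r => V (pt r p) 2) =O[atTop] (fun _ => (1 : ℝ)) ∧
    (fun r => V (pt r p) 3) =O[atTop] (fun _ => (1 : ℝ)) :=
  ⟨isBigO_one_of_tendsto_sq_mul_deriv (h.eventually_hasDerivAt hp 2)
    ((h.tendsto_sq_mul_pd hp).1.comp (tendsto_pt p)),
   isBigO_one_of_tendsto_sq_mul_deriv (h.eventually_hasDerivAt hp 3)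
    ((h.tendsto_sq_mul_pd hp).2.comp (tendsto_pt p))⟩

end IsInvariantKilling

/-! ### The tetrad components of a Killing field -/

lemma Lead.weaken {p : Scri} {f : Coord → ℝ} {k : ℤ} (hf : Lead p f k 0 0 0) {j : ℤ} (hj : k < j) :
    Lead p f j 0 0 0 := by
  have key : ∀ (F : Coord → ℝ) (i : ℤ), Tendsto (fun x => (x 1) ^ (i - k) • F x) (nearScri p) (𝓝 0) →
      Tendsto (fun x => (x 1) ^ (i - j) • F x) (nearScri p) (𝓝 0) := by
    intro F i hF
    have h1 : Tendsto (fun r : ℝ => r ^ (k - j)) atTop (𝓝 0) :=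
      tendsto_zpow_atTop_zero (by omega)
    have := (h1.comp (tendsto_radius p)).mul hF
    rw [zero_mul] at this
    refine this.congr' ?_
    filter_upwards [eventually_radius_pos p] with x hx
    rw [Function.comp, smul_eq_mul, smul_eq_mul, ← mul_assoc, ← zpow_add₀ hx.ne']
    congr 2; ring
  refine ⟨hf.diff, ?_, ?_, ?_, ?_⟩
  · simpa using key _ 0 (by simpa using hf.val)
  · simpa using key _ 0 (by simpa using hf.du)
  · simpa using key _ 1 (by simpa using hf.dr)
  · simpa using key _ 0 (by simpa using hf.dθ)

section Components

variable {S : Spacetime} {V : Coord → Coord} {a b : Coord → ℝ} {c : Coord → ℂ} {x : Coord}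

lemma HasTetradCoeffs.b_eq (h : HasTetradCoeffs S V a b c) (hx : x ∈ S.dom) : b x = V x 0 := by
  have := h x hx 0
  simp [lVec, nVec, mVec] at this
  exact_mod_cast this.symm

lemma HasTetradCoeffs.a_eq (h : HasTetradCoeffs S V a b c) (hx : x ∈ S.dom) :
    a x = V x 1 - V x 0 * S.Q x := by
  have := h x hx 1
  simp [lVec, nVec, mVec] at this
  have h1 : V x 1 = a x + b x * S.Q x := by exact_mod_cast this
  rw [← h.b_eq hx, h1]; ring

lemma HasTetradCoeffs.V2_eq (h : HasTetradCoeffs S V a b c) (hx : x ∈ S.dom) :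
    V x 2 = V x 0 * S.Cθ x
      - 2 * ((c x).re * (S.Xθ x).re - (c x).im * (S.Xθ x).im) := by
  have := congrArg Complex.re (h x hx 2)
  simp [lVec, nVec, mVec] at this
  rw [this, h.b_eq hx]; ring

lemma HasTetradCoeffs.V3_eq (h : HasTetradCoeffs S V a b c) (hx : x ∈ S.dom) :
    V x 3 = V x 0 * S.Cφ x
      - 2 * ((c x).re * (S.Xφ x).re - (c x).im * (S.Xφ x).im) := by
  have := congrArg Complex.re (h x hx 3)
  simp [lVec, nVec, mVec] at this
  rw [this, h.b_eq hx]; ring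

/-! ### Leading coefficients of a and c: absence of logarithms -/

namespace IsInvariantKilling

variable {p : Scri} {acoef ccoef : ℤ → Scri → Polynomial ℂ}

/-- Needed for ∂_θ ξ^r = o(r²) in the (uθ) equation. It follows from ξ^r = a + b Q, where a is O(r)
up to logarithms and its expansion may be differentiated. -/
lemma lead_V1 (h : IsInvariantKilling S V) (ht : HasTetradCoeffs S V a b c)
    (ha : HasPolyhomExpansion S.toRegion (fun x => (a x : ℂ)) (-1) acoef) (hp : p ∈ S.scri) :
    Lead p (fun y => V y 1) 2 0 0 0 := by
  have hd : ∀ᶠ x in nearScri p, DifferentiableAt ℝ (fun x => (a x : ℂ)) x := by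
    filter_upwards [Region.eventually_dom hp] with x hx
    have h1 : DifferentiableOn ℝ (fun x => V x 1 - V x 0 * S.Q x) S.dom :=
      (h.differentiableOn_apply 1).sub ((h.differentiableOn_apply 0).mul
        (S.Q_reg.smooth.differentiableOn (by simp)))
    have h2 : DifferentiableOn ℝ a S.dom := h1.congr fun y hy => ht.a_eq hy
    exact Complex.ofRealCLM.differentiableAt.comp x (differentiableAt_of_mem_dom h2 hx)
  have ha2 : Lead p a 2 0 0 0 := by simpa using (ha.lead_zero hd hp).clm Complex.reCLM
  have hQ := (((h.lead_V0 hp).mul (lead_Q hp)).of_eq (k' := 1) (L' := 0) (Lu' := 0) (Lθ' := 0)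
    (by norm_num) (by simp) (by simp) (by simp)).weaken (show (1 : ℤ) < 2 by norm_num)
  refine ((ha2.add hQ).of_eq rfl (by simp) (by simp) (by simp)).congr hp fun x hx _ => ?_
  rw [ht.a_eq hx]; ring

/-- On each generator a / r and ξ^r / r have the same limit because b Q = o(r). This removes the
logarithms and identifies a₋₁; the expansion then makes the limit joint. -/
lemma acoef_eq (h : IsInvariantKilling S V) (ht : HasTetradCoeffs S V a b c)
    (ha : HasPolyhomExpansion S.toRegion (fun x => (a x : ℂ)) (-1) acoef) (hp : p ∈ S.scri) :
    acoef (-1) p = Polynomial.C ((-pd 0 (fun y => V y 0) (S.base p) : ℝ) : ℂ) ∧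
    Tendsto (fun x => (x 1)⁻¹ * V x 1) (nearScri p) (𝓝 (-pd 0 (fun y => V y 0) (S.base p))) := by
  have hVQ : ∀ {q}, q ∈ S.scri →
      Tendsto (fun x => V x 0 * ((x 1)⁻¹ * S.Q x)) (nearScri q) (𝓝 0) := fun {q} hq => by
    have := (h.tendsto_V0 hq).mul (lead_Q hq).val
    simpa using this
  have hray : ∀ {q}, q ∈ S.scri → Tendsto (fun r => r⁻¹ * a (pt r q)) atTop
      (𝓝 (-pd 0 (fun y => V y 0) (S.base q))) := fun {q} hq => by
    have h1 := (h.tendsto_radial_component hq).sub ((hVQ hq).comp (tendsto_pt q))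
    rw [sub_zero] at h1
    refine h1.congr' ?_
    filter_upwards [(tendsto_pt q).eventually (Region.eventually_dom hq)] with r hr
    rw [ht.a_eq hr]
    simp only [Function.comp, pt_one]; ring
  have hC : ∀ q ∈ S.scri, acoef (-1) q = Polynomial.C ((acoef (-1) q).coeff 0) := by
    intro q hq
    refine ha.coef_eq_C hq ?_
    have h1 := (Complex.ofRealCLM.continuous.tendsto _).comp (hray hq)
    refine (h1.isBigO_one ℝ).congr_left fun r => ?_
    simp
  have hlim := ha.tendsto_coeff_zero hp hC
  have h0 : (acoef (-1) p).coeff 0 = ((-pd 0 (fun y => V y 0) (S.base p) : ℝ) : ℂ) := by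
    refine tendsto_nhds_unique (hlim.comp (tendsto_pt p))
      (((Complex.ofRealCLM.continuous.tendsto _).comp (hray hp)).congr fun r => ?_)
    simp
  refine ⟨by rw [hC p hp, h0], ?_⟩
  rw [h0] at hlim
  have h1 := ((Complex.reCLM.continuous.tendsto _).comp hlim).add (hVQ hp)
  rw [add_zero, Complex.reCLM_apply, Complex.ofReal_re] at h1
  refine h1.congr' ?_
  filter_upwards [Region.eventually_dom hp] with x hx
  simp only [Function.comp, Complex.reCLM_apply, Complex.smul_re, Complex.ofReal_re, ht.a_eq hx,
    smul_eq_mul, zpow_neg_one]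
  ring

lemma ccoef_eq (h : IsInvariantKilling S V) (ht : HasTetradCoeffs S V a b c)
    (hc : HasPolyhomExpansion S.toRegion c (-1) ccoef) (hp : p ∈ S.scri) :
    ccoef (-1) p = Polynomial.C ((ccoef (-1) p).coeff 0) := by
  have hs : Real.sin p.2.1 ≠ 0 := (Real.sin_pos_of_mem_Ioo hp.2).ne'
  refine hc.coef_eq_C hp ?_
  have hray := fun {F : Coord → ℝ} {L : ℝ} (hF : Tendsto F (nearScri p) (𝓝 L)) =>
    hF.comp (tendsto_pt p)
  have tθr := (lead_Xθ hp).1.val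
  have tθi := (lead_Xθ hp).2.val
  have tφr := (lead_Xφ hp).1.val
  have tφi := (lead_Xφ hp).2.val
  simp only [neg_neg, zpow_one, smul_eq_mul] at tθr tθi tφr tφi
  -- The formulas for ξ^θ and ξ^φ are a linear system for Re c and Im c. Its determinant, scaled by
  -- r², has a nonzero limit, so bounded angular components force c = O(r) by Cramer's rule.
  have tdet := (tθi.mul tφr).sub (tθr.mul tφi)
  have hne : 0 * 0 - 1 / √2 * -(1 / (√2 * Real.sin p.2.1)) ≠ 0 := by
    have : √2 ≠ 0 := by positivity
    simp [hs]
  have odet := ((hray (tdet.inv₀ hne)).isBigO_one ℝ)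
  have oCθ := (hray ((h.tendsto_V0 hp).mul ((lead_Cθ hp).tendsto_smaller
    (show (-1 : ℤ) < 0 by norm_num)))).isBigO_one ℝ
  have oCφ := (hray ((h.tendsto_V0 hp).mul ((lead_Cφ hp).tendsto_smaller
    (show (-1 : ℤ) < 0 by norm_num)))).isBigO_one ℝ
  have oθr := (hray tθr).isBigO_one ℝ
  have oθi := (hray tθi).isBigO_one ℝ
  have oφr := (hray tφr).isBigO_one ℝ
  have oφi := (hray tφi).isBigO_one ℝ
  have hV := h.isBigO_angular hp
  have oF := (oCθ.sub hV.1).const_mul_left (1 / 2)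
  have oG := (oCφ.sub hV.2).const_mul_left (1 / 2)
  have ore := ((oθi.mul oG).sub (oφi.mul oF)).mul odet
  have oim := ((oθr.mul oG).sub (oφr.mul oF)).mul odet
  simp only [mul_one] at ore oim
  have hev := ((tendsto_pt p).eventually (Region.eventually_dom hp)).and
    ((eventually_gt_atTop 0).and ((hray tdet).eventually_ne hne))
  have e1 : (fun r : ℝ => r⁻¹ * (c (pt r p)).re) =O[atTop] (fun _ => (1 : ℝ)) := by
    refine ore.congr' ?_ (Eventually.of_forall fun _ => rfl)
    filter_upwards [hev] with r ⟨hr, h0, hd⟩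
    simp only [Function.comp, pt_one] at hd ⊢
    rw [← div_eq_mul_inv, div_eq_iff hd, ht.V2_eq hr, ht.V3_eq hr]
    field_simp
    simp
    ring
  have e2 : (fun r : ℝ => r⁻¹ * (c (pt r p)).im) =O[atTop] (fun _ => (1 : ℝ)) := by
    refine oim.congr' ?_ (Eventually.of_forall fun _ => rfl)
    filter_upwards [hev] with r ⟨hr, h0, hd⟩
    simp only [Function.comp, pt_one] at hd ⊢
    rw [← div_eq_mul_inv, div_eq_iff hd, ht.V2_eq hr, ht.V3_eq hr]
    field_simp
    simp
    ring
  refine (IsBigO.of_bound 1 (Eventually.of_forall fun r => ?_)).trans (e1.norm_left.add e2.norm_left)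
  rw [one_mul, zpow_neg_one, Real.norm_of_nonneg (by positivity)]
  have := Complex.norm_le_abs_re_add_abs_im (r⁻¹ • c (pt r p))
  simpa only [Complex.smul_re, Complex.smul_im, smul_eq_mul, Real.norm_eq_abs] using this

lemma tendsto_angular (h : IsInvariantKilling S V) (ht : HasTetradCoeffs S V a b c)
    (hc : HasPolyhomExpansion S.toRegion c (-1) ccoef) (hp : p ∈ S.scri) :
    Tendsto (fun x => V x 2) (nearScri p) (𝓝 (-√2 * ((ccoef (-1) p).coeff 0).re)) ∧
    Tendsto (fun x => V x 3) (nearScri p)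
      (𝓝 (-√2 * ((ccoef (-1) p).coeff 0).im / Real.sin p.2.1)) := by
  have hs : Real.sin p.2.1 ≠ 0 := (Real.sin_pos_of_mem_Ioo hp.2).ne'
  have h2 : √2 ^ 2 = 2 := Real.sq_sqrt (by norm_num)
  have h0 : √2 ≠ 0 := by positivity
  have hlim := hc.tendsto_coeff_zero hp fun q hq => h.ccoef_eq ht hc hq
  have lre := (Complex.reCLM.continuous.tendsto _).comp hlim
  have lim := (Complex.imCLM.continuous.tendsto _).comp hlim
  have tCθ := (h.tendsto_V0 hp).mul ((lead_Cθ hp).tendsto_smaller (show (-1 : ℤ) < 0 by norm_num))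
  have tCφ := (h.tendsto_V0 hp).mul ((lead_Cφ hp).tendsto_smaller (show (-1 : ℤ) < 0 by norm_num))
  have key : ∀ z y w : ℝ, z ≠ 0 → (z ^ (-1 : ℤ) * y) * (z ^ (-(-1) : ℤ) * w) = y * w := by
    intro z y w hz
    rw [neg_neg, zpow_one, zpow_neg_one]; field_simp
  constructor
  · have := tCθ.sub (((lre.mul (lead_Xθ hp).1.val).sub (lim.mul (lead_Xθ hp).2.val)).const_mul 2)
    have e : V (S.base p) 0 * 0 - 2 * (Complex.reCLM ((ccoef (-1) p).coeff 0) * (1 / √2)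
        - Complex.imCLM ((ccoef (-1) p).coeff 0) * 0) = -√2 * ((ccoef (-1) p).coeff 0).re := by
      simp only [Complex.reCLM_apply]; field_simp; rw [h2]; ring
    rw [e] at this
    refine this.congr' ?_
    filter_upwards [Region.eventually_dom hp, eventually_radius_pos p] with x hx hx0
    rw [ht.V2_eq hx]
    simp only [Function.comp, Complex.reCLM_apply, Complex.imCLM_apply, Complex.smul_re,
      Complex.smul_im, smul_eq_mul, key _ _ _ hx0.ne', neg_zero, zpow_zero, one_mul]
  · have := tCφ.sub (((lre.mul (lead_Xφ hp).1.val).sub (lim.mul (lead_Xφ hp).2.val)).const_mul 2)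
    have e : V (S.base p) 0 * 0 - 2 * (Complex.reCLM ((ccoef (-1) p).coeff 0) * 0
        - Complex.imCLM ((ccoef (-1) p).coeff 0) * -(1 / (√2 * Real.sin p.2.1))) =
        -√2 * ((ccoef (-1) p).coeff 0).im / Real.sin p.2.1 := by
      simp only [Complex.imCLM_apply]; field_simp; rw [h2]; ring
    rw [e] at this
    refine this.congr' ?_
    filter_upwards [Region.eventually_dom hp, eventually_radius_pos p] with x hx hx0
    rw [ht.V3_eq hx]
    simp only [Function.comp, Complex.reCLM_apply, Complex.imCLM_apply, Complex.smul_re,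
      Complex.smul_im, smul_eq_mul, key _ _ _ hx0.ne', neg_zero, zpow_zero, one_mul]

/-! ### The conformal Killing equation at null infinity -/

/-- Radial growth ξ^r ~ A r compensates the power lost by ∂_r, so the radial term contributes A k L
at the same order as the others. -/
lemma tendsto_transport {V : Coord → Coord} {G : Coord → ℝ} {k : ℤ} {L Lu Lθ v₀ A X : ℝ}
    (hG : Lead p G k L Lu Lθ) (h0 : Tendsto (fun x => V x 0) (nearScri p) (𝓝 v₀))
    (h1 : Tendsto (fun x => (x 1)⁻¹ * V x 1) (nearScri p) (𝓝 A))
    (h2 : Tendsto (fun x => V x 2) (nearScri p) (𝓝 X)) :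
    Tendsto (fun x => (x 1) ^ (-k) * transport V G x) (nearScri p)
      (𝓝 (v₀ * Lu + A * (k * L) + X * Lθ)) := by
  refine (((h0.mul hG.du).add (h1.mul hG.dr)).add (h2.mul hG.dθ)).congr' ?_
  filter_upwards [eventually_radius_pos p] with x hx
  rw [transport, sub_eq_add_neg, zpow_add₀ hx.ne', zpow_one]
  simp only [smul_eq_mul, pd]
  field_simp

/-- The angular components and the expansion of the field at null infinity satisfy the conformal
Killing equation of the sphere and do not depend on `u`. -/
lemma tendsto_pd_angular (h : IsInvariantKilling S V) (hV1 : Lead p (fun y => V y 1) 2 0 0 0)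
    (hp : p ∈ S.scri) {A X : ℝ}
    (hA : Tendsto (fun x => (x 1)⁻¹ * V x 1) (nearScri p) (𝓝 A))
    (hX : Tendsto (fun x => V x 2) (nearScri p) (𝓝 X)) :
    A * Real.sin p.2.1 = -X * Real.cos p.2.1 ∧
    (Tendsto (pd 2 (fun y => V y 2)) (nearScri p) (𝓝 (-A)) ∧
      Tendsto (pd 2 (fun y => V y 3)) (nearScri p) (𝓝 0)) ∧
    (Tendsto (pd 0 (fun y => V y 2)) (nearScri p) (𝓝 0) ∧
      Tendsto (pd 0 (fun y => V y 3)) (nearScri p) (𝓝 0)) := by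
  have hs : Real.sin p.2.1 ≠ 0 := (Real.sin_pos_of_mem_Ioo hp.2).ne'
  have hV0 := h.tendsto_V0 hp
  have h02 := (lead_g02 hp).weaken (show (1 : ℤ) < 2 by norm_num)
  have h03 := (lead_g03 hp).weaken (show (1 : ℤ) < 2 by norm_num)
  have hdom := Region.eventually_dom hp
  have t33 := tendsto_transport (lead_g33 hp) hV0 hA hX
  have t22 := tendsto_transport (lead_g22 hp) hV0 hA hX
  have t23 := tendsto_transport (lead_g23 hp) hV0 hA hX
  have t02 := tendsto_transport h02 hV0 hA hX
  have t03 := tendsto_transport h03 hV0 hA hX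
  have q22 := (t22.const_mul (-(1 / 2))).sub (h02.val.mul (h.tendsto_pd hp 2))
  have q23 := t23.neg.sub (h03.val.mul (h.tendsto_pd hp 2))
  have sθ := tendsto_of_linear_system (lead_g22 hp).val (lead_g23 hp).val
    (lead_g33 hp).val (pow_ne_zero 2 hs) q22 q23
    (x := pd 2 (fun y => V y 2)) (y := pd 2 (fun y => V y 3))
    (by filter_upwards [hdom] with x hx
        simp only [smul_eq_mul]
        linear_combination (x 1) ^ (-2 : ℤ) * h.equation_22 hx)
    (by filter_upwards [hdom] with x hx
        simp only [smul_eq_mul]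
        linear_combination (x 1) ^ (-2 : ℤ) * h.equation_23 hx)
  have sθ' : Tendsto (pd 2 (fun y => V y 2)) (nearScri p) (𝓝 (-A)) ∧
      Tendsto (pd 2 (fun y => V y 3)) (nearScri p) (𝓝 0) := by
    convert sθ using 3
    · push_cast; ring
    · simp
  -- After division by r² every term on the right of the (uθ) equation vanishes; ∂_θ ξ^r is handled
  -- by `hV1`.
  have q02 := ((((t02.neg.sub (h02.val.mul (h.tendsto_pd hp 0))).sub
    ((tendsto_g00 hp).mul (h.tendsto_pd hp 2))).sub hV1.dθ).sub (h02.val.mul sθ'.1)).sub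
      (h03.val.mul sθ'.2)
  have q03 := t03.neg.sub (h03.val.mul (h.tendsto_pd hp 0))
  have su := tendsto_of_linear_system (lead_g22 hp).val (lead_g23 hp).val
    (lead_g33 hp).val (pow_ne_zero 2 hs) q02 q03
    (x := pd 0 (fun y => V y 2)) (y := pd 0 (fun y => V y 3))
    (by filter_upwards [hdom] with x hx
        have := h.equation_02 hx
        simp only [smul_eq_mul, pd] at this ⊢
        linear_combination (x 1) ^ (-2 : ℤ) * this)
    (by filter_upwards [hdom] with x hx
        simp only [smul_eq_mul]
        linear_combination (x 1) ^ (-2 : ℤ) * h.equation_03 hx)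
  refine ⟨?_, sθ', by simpa using su⟩
  have h0 : Tendsto (fun x => (x 1) ^ (-2 : ℤ) * transport V (fun y => S.g y 3 3) x)
      (nearScri p) (𝓝 0) := by
    refine tendsto_const_nhds.congr' ?_
    filter_upwards [hdom] with x hx
    rw [h.equation_33 hx, mul_zero]
  have e := tendsto_nhds_unique t33 h0
  push_cast at e
  refine mul_left_cancel₀ hs ?_
  linear_combination -1 / 2 * e

end IsInvariantKilling

end Components

/-! ### Asymptotic form of the Killing field -/

lemma fderiv_pt_zero (F : Coord → ℝ) (x : Coord) (v : Scri) :
    fderiv ℝ F x (pt 0 v) = v.1 * pd 0 F x + v.2.1 * pd 2 F x + v.2.2 * pd 3 F x := by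
  have : pt 0 v = v.1 • Pi.single 0 1 + v.2.1 • Pi.single 2 1 + v.2.2 • Pi.single 3 1 := by
    ext i; fin_cases i <;> simp [pt]
  rw [this, map_add, map_add, map_smul, map_smul, map_smul]
  rfl

lemma limit_const {D : Region} {F : Coord → ℝ} {L : Scri → ℝ} (hF : DifferentiableOn ℝ F D.dom)
    (h0 : ∀ p ∈ D.scri, Tendsto (pd 0 F) (nearScri p) (𝓝 0))
    (h2 : ∀ p ∈ D.scri, Tendsto (pd 2 F) (nearScri p) (𝓝 0))
    (h3 : ∀ p ∈ D.scri, Tendsto (pd 3 F) (nearScri p) (𝓝 0))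
    (hL : ∀ p ∈ D.scri, Tendsto F (nearScri p) (𝓝 (L p))) {p q : Scri} (hp : p ∈ D.scri)
    (hq : q ∈ D.scri) : L p = L q := by
  have := limit_eq_of_tendsto_fderiv hF (v := p - q) (fun p hp => ?_) hL hq (by simpa using hp)
  · simpa using this
  · simp only [fderiv_pt_zero]
    simpa using (((h0 p hp).const_mul _).add ((h2 p hp).const_mul _)).add ((h3 p hp).const_mul _)

lemma tendsto_coord_two (p : Scri) : Tendsto (fun x : Coord => x 2) (nearScri p) (𝓝 p.2.1) :=
  (continuous_snd.fst.tendsto p).comp (tendsto_toScri p)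

lemma pd_mul_inv_sin {F : Coord → ℝ} {x : Coord} (hF : DifferentiableAt ℝ F x)
    (hx : Real.sin (x 2) ≠ 0) (μ : Fin 4) :
    pd μ (fun y => F y * (Real.sin (y 2))⁻¹) x = pd μ F x * (Real.sin (x 2))⁻¹
      + F x * (-Real.cos (x 2) / Real.sin (x 2) ^ 2 * (Pi.single μ 1 : Coord) 2) := by
  have h1 : HasFDerivAt (fun y : Coord => (Real.sin (y 2))⁻¹)
      ((-Real.cos (x 2) / Real.sin (x 2) ^ 2) • (ContinuousLinearMap.proj 2 : Coord →L[ℝ] ℝ)) x :=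
    HasDerivAt.comp_hasFDerivAt (h₂ := fun θ : ℝ => (Real.sin θ)⁻¹) (f := fun y : Coord => y 2) x
      ((Real.hasDerivAt_sin (x 2)).inv hx)
      (ContinuousLinearMap.proj (R := ℝ) (φ := fun _ : Fin 4 => ℝ) 2).hasFDerivAt
  rw [pd, (hF.hasFDerivAt.fun_mul h1).fderiv, pd]
  simp
  ring

namespace IsInvariantKilling

variable {S : Spacetime} {V : Coord → Coord}

/-- The base radius R + 1 is merely continuous in θ. Radial constancy of ξ^u replaces it locally by
a fixed radius, at which ξ^u is smooth. -/
lemma contDiffOn_base (h : IsInvariantKilling S V) {u : ℝ} (hu : u ∈ S.I) (φ : ℝ) :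
    ContDiffOn ℝ ∞ (fun θ => V (S.base (u, θ, φ)) 0) (Set.Ioo 0 Real.pi) := by
  intro θ hθ
  have hp : ((u, θ, φ) : Scri) ∈ S.scri := ⟨hu, hθ⟩
  have hr := lt_add_one (S.R (u, θ))
  set r := S.R (u, θ) + 1
  have h2 : ContDiffAt ℝ ∞ (fun θ' => V (pt r (u, θ', φ)) 0) θ := by
    have h3 : ContDiffAt ℝ ∞ (fun y => V y 0) (pt r (u, θ, φ)) :=
      (h.contDiffOn_apply 0).contDiffAt (S.isOpen_dom.mem_nhds (Region.pt_mem_dom hp hr))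
    have h4 : ContDiff ℝ ∞ (fun θ' : ℝ => pt r (u, θ', φ)) :=
      contDiff_pt.comp (contDiff_const.prodMk (contDiff_const.prodMk
        (contDiff_id.prodMk contDiff_const)))
    exact ContDiffAt.comp (f := fun θ' : ℝ => pt r (u, θ', φ)) θ h3 h4.contDiffAt
  refine (h2.congr_of_eventuallyEq ?_).contDiffWithinAt
  have hc : ContinuousAt (fun θ' : ℝ => ((u, θ', φ) : Scri)) θ := by fun_prop
  filter_upwards [hc.eventually (h.radiallyConstant.eventually_eq hp hr)] with θ' hθ'
  exact hθ' _ (lt_add_one _)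

/-- The `u` component of an invariant Killing field whose expansion at null infinity is
`k cos θ`. -/
lemma exists_alpha (h : IsInvariantKilling S V) {k : ℝ}
    (hk : ∀ p ∈ S.scri, pd 0 (fun y => V y 0) (S.base p) = k * Real.cos p.2.1) :
    ∃ α : ℝ → ℝ, ContDiffOn ℝ ∞ α (Set.Ioo 0 Real.pi) ∧
      ∀ x ∈ S.dom, V x 0 = x 0 * (k * Real.cos (x 2)) + α (x 2) := by
  obtain ⟨u, hu⟩ := S.I_nonempty
  -- α is read off at a reference time u and φ = 0. Subtracting the linear term leaves a function
  -- constant in u and φ.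
  refine ⟨fun θ => V (S.base (u, θ, 0)) 0 - u * (k * Real.cos θ),
    (h.contDiffOn_base hu 0).sub (by fun_prop), fun x hx => ?_⟩
  have hd : ∀ x : Coord,
      HasFDerivAt (fun x : Coord => x 0 * (k * Real.cos (x 2)))
        (x 0 • (k * -Real.sin (x 2)) • (ContinuousLinearMap.proj 2 : Coord →L[ℝ] ℝ)
          + (k * Real.cos (x 2)) • (ContinuousLinearMap.proj 0 : Coord →L[ℝ] ℝ)) x := by
    intro x
    have h1 : HasFDerivAt (fun x : Coord => k * Real.cos (x 2))
        ((k * -Real.sin (x 2)) • (ContinuousLinearMap.proj 2 : Coord →L[ℝ] ℝ)) x :=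
      HasDerivAt.comp_hasFDerivAt (h₂ := fun θ : ℝ => k * Real.cos θ) (f := fun y : Coord => y 2) x
        ((Real.hasDerivAt_cos (x 2)).const_mul k)
        (ContinuousLinearMap.proj (R := ℝ) (φ := fun _ : Fin 4 => ℝ) 2).hasFDerivAt
    exact (ContinuousLinearMap.proj (R := ℝ) (φ := fun _ : Fin 4 => ℝ) 0).hasFDerivAt.fun_mul h1
  have hq : ((u, x 2, 0) : Scri) ∈ S.scri := ⟨hu, hx.2.1⟩
  have hx' := Region.mem_scri_of_mem_dom hx
  have key := limit_eq_of_tendsto_fderiv (D := S.toRegion)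
    (F := fun x => V x 0 - x 0 * (k * Real.cos (x 2)))
    (L := fun p => V (S.base p) 0 - p.1 * (k * Real.cos p.2.1))
    (v := (x 0 - u, 0, x 3)) (q := (u, x 2, 0))
    ((h.differentiableOn_apply 0).sub (by fun_prop)) ?_ ?_ hq (by simpa [toScri] using! hx')
  · simp only [Prod.mk_add_mk, add_sub_cancel, add_zero, zero_add] at key
    rw [h.eq_base hx]
    simp only [toScri]
    linarith
  · intro p hp
    refine tendsto_const_nhds.congr' ?_
    filter_upwards [Region.eventually_dom hp] with y hy
    have h1 := (differentiableAt_of_mem_dom (h.differentiableOn_apply 0) hy).hasFDerivAt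
    rw [(h1.fun_sub (hd y)).fderiv]
    have h2 := h.pd_eq_base hy 0
    rw [hk _ (Region.mem_scri_of_mem_dom hy)] at h2
    simp only [sub_apply, fderiv_pt_zero, h2, h.invariant y hy]
    simp [toScri]
    ring
  · intro p hp
    have h1 : Tendsto (fun x : Coord => x 0) (nearScri p) (𝓝 p.1) :=
      (continuous_fst.tendsto p).comp (tendsto_toScri p)
    exact (h.tendsto_V0 hp).sub (h1.mul (((Real.continuous_cos.tendsto _).comp
      (tendsto_coord_two p)).const_mul k))

/-- The limits of the components of an invariant Killing field at null infinity. -/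
lemma exists_limits (h : IsInvariantKilling S V)
    (hV1 : ∀ p ∈ S.scri, Lead p (fun y => V y 1) 2 0 0 0) {A X Y : Scri → ℝ}
    (hA : ∀ p ∈ S.scri, Tendsto (fun x => (x 1)⁻¹ * V x 1) (nearScri p) (𝓝 (A p)))
    (hX : ∀ p ∈ S.scri, Tendsto (fun x => V x 2) (nearScri p) (𝓝 (X p)))
    (hY : ∀ p ∈ S.scri, Tendsto (fun x => V x 3) (nearScri p) (𝓝 (Y p))) :
    ∃ k w : ℝ, ∀ p ∈ S.scri,
      A p = -k * Real.cos p.2.1 ∧ X p = k * Real.sin p.2.1 ∧ Y p = w := by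
  obtain ⟨u, hu⟩ := S.I_nonempty
  -- A reference point on the equator, where sin θ = 1, so that the constant X / sin θ is X itself
  -- there.
  have hq : ((u, Real.pi / 2, 0) : Scri) ∈ S.scri :=
    ⟨hu, by constructor <;> simp only <;> linarith [Real.pi_pos]⟩
  have hs : ∀ {p}, p ∈ S.scri → Real.sin p.2.1 ≠ 0 := fun hp =>
    (Real.sin_pos_of_mem_Ioo hp.2).ne'
  have hsd : ∀ {x}, x ∈ S.dom → Real.sin (x 2) ≠ 0 := fun hx =>
    (Real.sin_pos_of_mem_Ioo hx.2.1).ne'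
  have H := fun p (hp : p ∈ S.scri) => h.tendsto_pd_angular (hV1 p hp) hp (hA p hp) (hX p hp)
  have h3 : ∀ μ, ∀ p ∈ S.scri, Tendsto (pd 3 (fun y => V y μ)) (nearScri p) (𝓝 0) :=
    fun μ p hp => tendsto_const_nhds.congr' <| by
      filter_upwards [Region.eventually_dom hp] with x hx using (h.invariant x hx μ).symm
  have hYc : ∀ p ∈ S.scri, Y p = Y (u, Real.pi / 2, 0) := fun p hp =>
    limit_const (h.differentiableOn_apply 3) (fun p hp => (H p hp).2.2.2)
      (fun p hp => (H p hp).2.1.2) (h3 3) hY hp hq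
  have hsin : ∀ p ∈ S.scri, Tendsto (fun x : Coord => (Real.sin (x 2))⁻¹) (nearScri p)
      (𝓝 (Real.sin p.2.1)⁻¹) := fun p hp =>
    ((Real.continuous_sin.tendsto _).comp (tendsto_coord_two p)).inv₀ (hs hp)
  have hev : ∀ μ, ∀ p ∈ S.scri, ∀ᶠ x in nearScri p,
      pd μ (fun y => V y 2) x * (Real.sin (x 2))⁻¹
      + V x 2 * (-Real.cos (x 2) / Real.sin (x 2) ^ 2 * (Pi.single μ 1 : Coord) 2) =
      pd μ (fun y => V y 2 * (Real.sin (y 2))⁻¹) x := fun μ p hp => by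
    filter_upwards [Region.eventually_dom hp] with x hx
    rw [pd_mul_inv_sin (differentiableAt_of_mem_dom (h.differentiableOn_apply 2) hx) (hsd hx)]
  have hXc : ∀ p ∈ S.scri, X p * (Real.sin p.2.1)⁻¹ = X (u, Real.pi / 2, 0) := fun p hp => by
    have hd : DifferentiableOn ℝ (fun y => V y 2 * (Real.sin (y 2))⁻¹) S.dom :=
      (h.differentiableOn_apply 2).mul (DifferentiableOn.inv (by fun_prop) fun x hx => hsd hx)
    have := limit_const (L := fun p => X p * (Real.sin p.2.1)⁻¹) hd (fun p hp => ?_)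
      (fun p hp => ?_) (fun p hp => ?_) (fun p hp => (hX p hp).mul (hsin p hp)) hp hq
    · simpa using this
    · have := (H p hp).2.2.1.mul (hsin p hp)
      rw [zero_mul] at this
      exact this.congr' ((hev 0 p hp).mono fun x hx => by rw [← hx]; simp)
    · have hcos := (Real.continuous_cos.tendsto _).comp (tendsto_coord_two p)
      have := ((H p hp).2.1.1.mul (hsin p hp)).add
        ((hX p hp).mul (hcos.neg.mul ((hsin p hp).pow 2)))
      -- Limit of ∂_θ(ξ^θ / sin θ); it vanishes by A sin θ = -X cos θ.
      have e : -A p * (Real.sin p.2.1)⁻¹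
          + X p * (-Real.cos p.2.1 * (Real.sin p.2.1)⁻¹ ^ 2) = 0 := by
        have := hs hp
        field_simp
        linear_combination -(H p hp).1
      rw [e] at this
      exact this.congr' ((hev 2 p hp).mono fun x hx => by
        rw [← hx]; simp [div_eq_mul_inv])
    · have := (h3 2 p hp).mul (hsin p hp)
      rw [zero_mul] at this
      exact this.congr' ((hev 3 p hp).mono fun x hx => by rw [← hx]; simp)
  refine ⟨X (u, Real.pi / 2, 0), Y (u, Real.pi / 2, 0), fun p hp => ?_⟩
  have hXp : X p = X (u, Real.pi / 2, 0) * Real.sin p.2.1 := by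
    rw [← hXc p hp]; have := hs hp; field_simp
  refine ⟨mul_right_cancel₀ (hs hp) ?_, hXp, hYc p hp⟩
  rw [(H p hp).1, hXp]; ring

end IsInvariantKilling

/-- The added field has constant components, so the Lie derivative of g changes only by t ∂_φ g = 0.
-/
lemma IsKilling.add_smul_axial {S : Spacetime} (hS : IsAxisymmetric S) {V : Coord → Coord}
    (hV : IsKilling S V) (t : ℝ) : IsKilling S (fun x => V x + t • axial x) := by
  have hd : ∀ x ∈ S.dom, ∀ μ ν, pd μ (fun y => (V y + t • axial y) ν) x =
      pd μ (fun y => V y ν) x := by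
    intro x _ μ ν
    have : (fun y => (V y + t • axial y) ν) = fun y => V y ν + t * axial 0 ν := rfl
    rw [this, pd, fderiv_add_const, pd]
  refine ⟨⟨hV.reg.smooth.add (contDiffOn_const (c := t • axial 0)), fun x hx => ?_⟩, fun x hx μ ν => ?_⟩
  · rw [hV.reg.periodic x hx]; rfl
  · have h1 := hV.killing x hx μ ν
    have h2 := hS.pd_metric hx μ ν
    simp only [hd x hx]
    simp only [Fin.sum_univ_four] at h1 ⊢
    simp only [Pi.add_apply, Pi.smul_apply, axial_eq, smul_eq_mul]
    simp only [Pi.single_apply, Fin.reduceEq, if_false, if_true, mul_zero, add_zero, mul_one]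
    linear_combination h1 + t * h2

lemma AsymptoticTo.add_of_sub {D : Region} {V W U : Coord → Coord}
    (h : AsymptoticTo D V (fun x => W x - U x)) : AsymptoticTo D (fun x => V x + U x) W := by
  intro p hp
  refine ⟨fun μ hμ => ((h p hp).1 μ hμ).congr_left fun x => ?_,
    (h p hp).2.congr_left fun x => ?_⟩ <;> simp only [Pi.sub_apply, Pi.add_apply] <;> ring

end NPKilling

end

/-! ### Assembly of the theorem -/

open NPKilling in
theorem mainTheorem4 (S : NPKilling.Spacetime) (hS : NPKilling.IsAxisymmetric S)
    (ξ : NPKilling.Coord → NPKilling.Coord) (hξ : NPKilling.IsKilling S ξ)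
    (hindep : ∀ s t : ℝ, (∀ x ∈ S.dom, s • NPKilling.axial x + t • ξ x = 0) → s = 0 ∧ t = 0)
    (halg : ∃ s t : ℝ, ∀ x ∈ S.dom,
      VectorField.lieBracket ℝ NPKilling.axial ξ x = s • NPKilling.axial x + t • ξ x)
    (a b : NPKilling.Coord → ℝ) (c : NPKilling.Coord → ℂ)
    (habc : NPKilling.HasTetradCoeffs S ξ a b c)
    (acoef ccoef : ℤ → NPKilling.Scri → Polynomial ℂ)
    (ha : NPKilling.HasPolyhomExpansion S.toRegion (fun x => (a x : ℂ)) (-1) acoef)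
    (hc : NPKilling.HasPolyhomExpansion S.toRegion c (-1) ccoef) :
    (∀ x ∈ S.dom, VectorField.lieBracket ℝ NPKilling.axial ξ x = 0) ∧
    ∃ (A₀ : ℂ) (α : ℝ → ℝ), ContDiffOn ℝ ∞ α (Set.Ioo 0 Real.pi) ∧
      (∀ p ∈ S.scri, ccoef (-1) p = Polynomial.C (A₀ * (Real.sin p.2.1 : ℂ))) ∧
      (∀ p ∈ S.scri, acoef (-1) p =
        Polynomial.C (1 / (Real.sqrt 2 : ℂ) * (A₀ + conj A₀) * (Real.cos p.2.1 : ℂ))) ∧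
      (∀ x ∈ S.dom, (b x : ℂ) =
        -((x 0 : ℝ) : ℂ) / (Real.sqrt 2 : ℂ) * (A₀ + conj A₀) * (Real.cos (x 2) : ℂ)
          + (α (x 2) : ℂ)) ∧
      NPKilling.AsymptoticTo S.toRegion ξ
        (fun x => NPKilling.boostRotation (Real.sqrt 2 * A₀.re) α x
          - (Real.sqrt 2 * A₀.im) • NPKilling.axial x) ∧
      NPKilling.IsKilling S (fun x => ξ x + (Real.sqrt 2 * A₀.im) • NPKilling.axial x) ∧
      NPKilling.AsymptoticTo S.toRegion
        (fun x => ξ x + (Real.sqrt 2 * A₀.im) • NPKilling.axial x)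
        (NPKilling.boostRotation (Real.sqrt 2 * A₀.re) α) := by
  obtain ⟨s, t, hst⟩ := halg
  have hcomm := lieBracket_axial_eq_zero hξ.reg hst
  have h : IsInvariantKilling S ξ := ⟨hS, hξ, fun x hx μ => by
    rw [pd_apply (differentiableAt_of_mem_dom (hξ.reg.smooth.differentiableOn (by simp)) hx),
      ← lieBracket_axial, hcomm x hx]; rfl⟩
  have hA := fun p (hp : p ∈ S.scri) => h.acoef_eq habc ha hp
  have hXY := fun p (hp : p ∈ S.scri) => h.tendsto_angular habc hc hp
  obtain ⟨k, w, hlim⟩ := h.exists_limits (fun p hp => h.lead_V1 habc ha hp)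
    (fun p hp => (hA p hp).2) (fun p hp => (hXY p hp).1) (fun p hp => (hXY p hp).2)
  obtain ⟨α, hα, hVα⟩ := h.exists_alpha (k := k) fun p hp => by linarith [(hlim p hp).1]
  have h2 : √2 * √2 = 2 := Real.mul_self_sqrt (by norm_num)
  have h0 : √2 ≠ 0 := by positivity
  -- The limits -√2 Re c₋₁ = k sin θ and -√2 Im c₋₁ / sin θ = w dictate Re A₀ = -k / √2 and Im A₀ =
  -- -w / √2, hence κ = -k.
  have eκ : √2 * (-k / √2) = -k := by field_simp
  have ew : √2 * (-w / √2) = -w := by field_simp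
  have hcos : ∀ y : ℝ, (1 / √2 * (2 * (-k / √2)) * y) = -k * y := fun y => by
    field_simp; linear_combination y * k * h2
  have hasym : AsymptoticTo S.toRegion ξ
      (fun x => boostRotation (√2 * (-k / √2)) α x - (√2 * (-w / √2)) • axial x) := by
    rw [eκ, ew]
    intro p hp
    have hl := hlim p hp
    have t1 := (hA p hp).2
    have t2 := (hXY p hp).1
    have t3 := (hXY p hp).2
    rw [hl.1] at t1
    rw [hl.2.1] at t2
    rw [hl.2.2] at t3
    have hsin := (Real.continuous_sin.tendsto _).comp (tendsto_coord_two p)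
    have hcos := (Real.continuous_cos.tendsto _).comp (tendsto_coord_two p)
    refine ⟨fun μ hμ => (isLittleO_one_iff ℝ).2 ?_, ?_⟩
    · fin_cases μ
      · refine tendsto_const_nhds.congr' ?_
        filter_upwards [Region.eventually_dom hp] with x hx
        simp [hVα x hx, boostRotation, axial]
        ring
      · exact absurd rfl hμ
      · have := t2.sub (hsin.const_mul k)
        rw [sub_self] at this
        refine this.congr fun x => ?_
        simp [boostRotation, axial]
      · have := t3.sub_const w
        rw [sub_self] at this
        refine this.congr fun x => ?_
        simp [boostRotation, axial]
    · have := t1.sub (hcos.const_mul (-k))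
      rw [sub_self] at this
      have h3 := ((isLittleO_one_iff ℝ).2 this).mul_isBigO
        (isBigO_refl (fun x : Coord => x 1) (nearScri p))
      refine h3.congr' ?_ (Eventually.of_forall fun x => one_mul _)
      filter_upwards [eventually_radius_pos p] with x hx
      simp [boostRotation, axial]
      field_simp
  refine ⟨hcomm, ⟨-k / √2, -w / √2⟩, α, hα, fun p hp => ?_, fun p hp => ?_, fun x hx => ?_,
    hasym, hξ.add_smul_axial hS _, hasym.add_of_sub⟩
  · have hs : Real.sin p.2.1 ≠ 0 := (Real.sin_pos_of_mem_Ioo hp.2).ne'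
    rw [h.ccoef_eq habc hc hp]
    congr 1
    obtain ⟨-, e1, e2⟩ := hlim p hp
    rw [div_eq_iff hs] at e2
    apply Complex.ext
    · rw [Complex.re_mul_ofReal]; field_simp; linarith
    · rw [Complex.im_mul_ofReal]; field_simp; linarith
  · rw [(hA p hp).1, (hlim p hp).1, Complex.add_conj, ← hcos]
    push_cast
    rfl
  · rw [habc.b_eq hx, hVα x hx, Complex.add_conj]
    have : x 0 * (k * Real.cos (x 2)) = -(x 0) / √2 * (2 * (-k / √2)) * Real.cos (x 2) := by
      linear_combination x 0 * hcos (Real.cos (x 2))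
    rw [this]
    push_cast
    rfl
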